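/- **Setting.** Let $\mathbb H_{\mathbb C}=\mathrm{Mat}_2(\mathbb C)$, $\mathbb H_{\mathbb C}^\times=GL_2(\mathbb C)$, $N(Z)=\det Z$, and let $\textit{Zh}$ (written Ж) be $\mathbb C[z_{11},z_{12},z_{21},z_{22},N(Z)^{-1}]$, regarded as functions on $\mathbb H_{\mathbb C}^\times$. For $l\in\{0,\frac12,1,\dots\}$ and $m,n\in\{-l,-l+1,\dots,l\}$ let $t^l_{n\underline m}(Z)$ be the coefficient of $s^{l-n}$ in $(sz_{11}+z_{21})^{l-m}(sz_{12}+z_{22})^{l+m}$. The functions $e^+_{l,n,m}(Z)=t^l_{n\underline m}(Z)$ and $e^-_{l,n,m}(Z)=N(Z)^{-1}t^l_{m\underline n}(Z^{-1})$ span spaces $\mathcal H^+$, $\mathcal H^-$; put $\mathcal H=\mathcal H^+\oplus\mathcal H^-$, with the pairing $\langle\phi_1,\phi_2\rangle=\frac1{2\pi^2}\int_{SU(2)}\bigl((\deg+1)\phi_1\bigr)\phi_2\,dS$ on $\mathcal H^\pm\times\mathcal H^\mp$ and $0$ on $\mathcal H^\pm\times\mathcal H^\pm$ ($\deg$ is the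 Euler operator, $dS$ the surface measure of $SU(2)=S^3$). Let $\mathcal{HH}$ be the space of formal series $\sum c^{\varepsilon\varepsilon'}_{ij}\,e^\varepsilon_i(Z_1)\,e^{\varepsilon'}_j(Z_2)$ with finitely many nonzero coefficients with $\varepsilon=\varepsilon'$, and $|l-l'|$ bounded over the nonzero coefficients with $\varepsilon\ne\varepsilon'$. Convolution on $\mathcal{HH}$ is the extension of $(\phi_1\otimes\phi_2)\ast(\phi_1'\otimes\phi_2')=\langle\phi_2,\phi_1'\rangle\,\phi_1\otimes\phi_2'$. Let $U(2)_R=R\cdot U(2)$, $\mathbb D^+_R=\{ZZ^*<R^2\}$, $\mathbb D^-_R=\{ZZ^*>R^2\}$ and $dV=dz^0\wedge dz^1\wedge dz^2\wedge dz^3$ (where $Z=\sum_k z^ke_k$ in the quaternionic basis), with $U(2)_R$ oriented so that $\frac i{2\pi^3}\int_{U(2)_R}N(W)^{-2}dV=1$. The map $I=I^{++}-(I^{+-}+I^{-+})+I^{--}:\textit{Zh}\to\mathcal{HH}$ is defined as follows: $I^{\pm\pm}(f)\in\mathcal H^\pm\otimes\mathcal H^\pm$ is the element equal to $\frac i{2\pi^3}\int_{U(2)_R}\frac{f(W)\,dV}{N(W-Z_1)N(W-Z_2)}$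 on $\mathbb D_R^\pm\times\mathbb D_R^\pm$, and $I^{\pm\mp}(f)$ is the formal series whose coefficient at $e^\pm_i(Z_1)e^\mp_j(Z_2)$ is $\frac i{2\pi^3}\int_{U(2)_R}f\,e^\mp_i\,e^\pm_j\,dV$ (all independent of $R>0$). For $d\in\mathbb Z$ the operators $(\deg+d)^{-1}_{Z_k}$ multiply $e^+_{l,n,m}(Z_k)$ by $\frac1{2l+d}$ if $2l+d>0$ and $e^-_{l,n,m}(Z_k)$ by $-\frac1{2l+2-d}$ if $2l+2-d>0$, and discard the other terms. Let $\mathcal{HH}^\omega\subset\mathcal{HH}$ be the smallest subspace containing $\mathcal H\otimes\mathcal H$ and $I(\textit{Zh})$ and stable under all $(\deg+d)^{-1}_{Z_1}$, $(\deg+d)^{-1}_{Z_2}$ and under the termwise actions $\pi^0_l\otimes1$, $1\otimes\pi^0_r$ of $\mathfrak{gl}(2,\mathbb H_{\mathbb C})$, where $\pi^0_l,\pi^0_r$ are the differentials of $\phi\mapsto N(cZ+d)^{-1}\phi((aZ+b)(cZ+d)^{-1})$ and $\phi\mapsto N(a'-Zc')^{-1}\phi((a'-Zc')^{-1}(-b'+Zd'))$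 for $h=\begin{pmatrix}a'&b'\\c'&d'\end{pmatrix}$, $h^{-1}=\begin{pmatrix}a&b\\c&d\end{pmatrix}$. Let $\Omega$ (resp. $\Lambda^+$, $\Lambda^-$) be the set of $(Z_1,Z_2)\in\mathbb H_{\mathbb C}^\times\times\mathbb H_{\mathbb C}^\times$ such that no eigenvalue of $Z_1Z_2^{-1}$ is a positive real number (resp. both have positive, both have negative imaginary part). A series $F$ is realized as an analytic function on $\Omega$ by adding its two finite parts ($\varepsilon=\varepsilon'$) and the analytic extensions to $\Omega$ of its parts with $(\varepsilon,\varepsilon')=(+,-)$ and $(-,+)$, summed over $m,n,m',n'$ first, which converge on $\mathbb D^+_R\times\mathbb D^-_R$ and $\mathbb D^-_R\times\mathbb D^+_R$ respectively, for all $R>0$. $F\in\mathcal{HH}^\omega$ is *extendable* if it is so realized and each $(Z_0,Z_0)$, $Z_0\in\mathbb H_{\mathbb C}^\times$, has an open neighbourhood $V\subset\mathbb H_{\mathbb C}^\times\times\mathbb H_{\mathbb C}^\times$ with analytic functions $F^\pm$ on $V$ such that $F=F^\pm$ on $\Lambda^\pm\cap V$. Then $(\mathrm{Diag}^\pm F)(Z)=\lim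 F(Z_1,Z_2)$ as $Z_1,Z_2\to Z$ with $(Z_1,Z_2)\in\Lambda^\pm$. For $f,g\in\textit{Zh}$ one puts $f\ast^\pm g=\mathrm{Diag}^\pm(I(f)\ast I(g))$ whenever $I(f)\ast I(g)$ is extendable and this limit lies in $\textit{Zh}$. **Proposition.** For each integer $n\ge1$, the $n$-fold convolution $I(N(Z)^{-1})\ast\dots\ast I(N(Z)^{-1})$ belongs to $\mathcal{HH}^\omega$, is extendable, and $$\mathrm{Diag}^\pm\bigl(\underbrace{I(N(Z)^{-1})\ast\dots\ast I(N(Z)^{-1})}_{n}\bigr)=\kappa_n^\pm\,N(Z)^{-1},\qquad \kappa_n^+=(2\pi i)^{n-1}\frac{B_{n-1}(0)}{(n-1)!},\quad \kappa_n^-=(2\pi i)^{n-1}\frac{B_{n-1}(1)}{(n-1)!},$$ where $B_k(x)$ are the Bernoulli polynomials. In particular $$N(Z)^{-1}\ast^{\pm}N(Z)^{-1}=\mp\pi i\,N(Z)^{-1},$$ and neither $\ast^+$ nor $\ast^-$ is associative: for each sign there are $f,g,h\in\textit{Zh}$ for which all the products involved are defined and $(f\ast^\pm g)\ast^\pm h\ne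 f\ast^\pm(g\ast^\pm h)$. -/

import Mathlib

open Filter Topology MeasureTheory
open scoped Matrix Matrix.Norms.Elementwise ComplexOrder

noncomputable section

namespace QuatAlg

/-- The complexified quaternions `ℍ_ℂ`, identified with complex `2 × 2` matrices.
The quaternionic norm is `N(Z) = det Z`. -/
abbrev HC : Type := Matrix (Fin 2) (Fin 2) ℂ

/-- The group `ℍ_ℂ^×` of invertible elements. -/
abbrev HCx : Type := GL (Fin 2) ℂ

/-! ### Matrix coefficients and the harmonic basis -/

/-- Labels `(l, n, m)` of matrix coefficients.  The half-integer `l` is recorded as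
`L = 2l ∈ ℕ`; the first entry of the pair is `l - n ∈ {0, …, 2l}`, the second is
`l - m ∈ {0, …, 2l}`. -/
abbrev Lab : Type := Σ L : ℕ, Fin (L + 1) × Fin (L + 1)

/-- The matrix coefficient
`t^l_{n m}(Z) = (2πi)⁻¹ ∮ (s z₁₁ + z₂₁)^{l-m} (s z₁₂ + z₂₂)^{l+m} s^{-l+n} ds/s`.
By the residue theorem it is the coefficient of `s^{l-n}` in the polynomial
`(s z₁₁ + z₂₁)^{l-m} (s z₁₂ + z₂₂)^{l+m}`.  Arguments: `L = 2l`, `p = l - n`, `q = l - m`. -/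
def tCoeff (L : ℕ) (p q : Fin (L + 1)) (Z : HC) : ℂ :=
  ((Polynomial.C (Z 0 0) * Polynomial.X + Polynomial.C (Z 1 0)) ^ (q : ℕ) *
    (Polynomial.C (Z 0 1) * Polynomial.X + Polynomial.C (Z 1 1)) ^ (L - (q : ℕ))).coeff (p : ℕ)

/-- Labels of the basis of `𝓗 = 𝓗⁺ ⊕ 𝓗⁻`; `true` stands for `+` and `false` for `-`. -/
abbrev Idx : Type := Bool × Lab

/-- The basis of `𝓗`: `t^l_{n m}(Z)` for the sign `+`, and `N(Z)⁻¹ t^l_{m n}(Z⁻¹)` for the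
sign `-`. -/
def basisFn : Idx → HC → ℂ
  | (true, ⟨L, n, m⟩), Z => tCoeff L n m Z
  | (false, ⟨L, n, m⟩), Z => Z.det⁻¹ * tCoeff L m n Z⁻¹

/-! ### The invariant pairing on `𝓗` -/

/-- The unit sphere `S³ ⊂ ℝ⁴`. -/
abbrev S3 : Type := Metric.sphere (0 : EuclideanSpace ℝ (Fin 4)) 1

/-- The identification of `S³` with `SU(2)`: `x ↦ x⁰e₀ + x¹e₁ + x²e₂ + x³e₃` (a unit
quaternion). -/
def toSU2 (x : S3) : HC :=
  !![(x.1 0 : ℂ) - Complex.I * (x.1 3 : ℂ), -Complex.I * (x.1 1 : ℂ) - (x.1 2 : ℂ);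
     -Complex.I * (x.1 1 : ℂ) + (x.1 2 : ℂ), (x.1 0 : ℂ) + Complex.I * (x.1 3 : ℂ)]

/-- `∫_{SU(2)} g dS`, where `dS` is the Euclidean surface measure of the unit sphere (of total
mass `2π²`). -/
def intSU2 (g : HC → ℂ) : ℂ :=
  ∫ x : S3, g (toSU2 x) ∂((volume : Measure (EuclideanSpace ℝ (Fin 4))).toSphere)

/-- The operator `deg + 1`, where `deg` is the Euler operator
`(deg φ)(Z) = d/ds φ(sZ)` at `s = 1`. -/
def degTilde (φ : HC → ℂ) (Z : HC) : ℂ :=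
  deriv (fun s : ℂ => φ (s • Z)) 1 + φ Z

/-- The antisymmetric invariant pairing on `𝓗`, on basis elements:
`(2π²)⁻¹ ∫_{SU(2)} ((deg + 1) φ₁) φ₂ dS` on `𝓗^± × 𝓗^∓`, and zero on `𝓗^± × 𝓗^±`. -/
def pairing (i j : Idx) : ℂ :=
  if i.1 = j.1 then 0
  else (1 / (2 * (Real.pi : ℂ) ^ 2)) *
    intSU2 (fun Z => degTilde (basisFn i) Z * basisFn j Z)

/-! ### The space `𝓗𝓗` of formal series and the convolution -/

/-- Arrays of coefficients of formal series
`∑_{i,j} F i j · basisFn i (Z₁) · basisFn j (Z₂)`. -/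
abbrev Arr : Type := Idx → Idx → ℂ

/-- The space `𝓗𝓗`: only finitely many coefficients with equal signs are nonzero, and the
nonzero coefficients with opposite signs have bounded `|l - l'|`. -/
def HH : Submodule ℂ Arr where
  carrier := {F | {p : Idx × Idx | p.1.1 = p.2.1 ∧ F p.1 p.2 ≠ 0}.Finite ∧
    ∃ K : ℕ, ∀ i j : Idx, i.1 ≠ j.1 → F i j ≠ 0 →
      i.2.1 ≤ j.2.1 + K ∧ j.2.1 ≤ i.2.1 + K}
  zero_mem' := by
    refine ⟨?_, 0, fun i j _ h => absurd rfl h⟩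
    simp
  add_mem' := by
    rintro F G ⟨hF, K, hK⟩ ⟨hG, M, hM⟩
    refine ⟨(hF.union hG).subset ?_, max K M, ?_⟩
    · rintro p ⟨hp, hne⟩
      by_cases h : F p.1 p.2 = 0
      · refine Or.inr ⟨hp, fun h' => hne ?_⟩
        simp [h, h']
      · exact Or.inl ⟨hp, h⟩
    · intro i j hij hne
      by_cases h : F i j = 0
      · have h' : G i j ≠ 0 := fun h' => hne (by simp [h, h'])
        have := hM i j hij h'
        omega
      · have := hK i j hij h
        omega
  smul_mem' := by
    rintro c F ⟨hF, K, hK⟩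
    refine ⟨hF.subset ?_, K, ?_⟩
    · rintro p ⟨hp, hne⟩
      exact ⟨hp, fun h => hne (by simp [h])⟩
    · intro i j hij hne
      exact hK i j hij fun h => hne (by simp [h])

/-- The convolution: the extension to `𝓗𝓗` of
`(φ₁ ⊗ φ₂) ∗ (φ₁' ⊗ φ₂') = ⟨φ₂, φ₁'⟩ φ₁ ⊗ φ₂'`.
For elements of `𝓗𝓗` the sum has finitely many nonzero terms. -/
def conv (F G : Arr) : Arr := fun i k =>
  ∑ᶠ p : Idx × Idx, F i p.1 * pairing p.1 p.2 * G p.2 k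

/-- The `n`-fold convolution `F ∗ ⋯ ∗ F` (`n ≥ 1`; the value at `n = 0` is never used). -/
def nConv (F : Arr) : ℕ → Arr
  | 0 => 0
  | 1 => F
  | n + 2 => conv (nConv F (n + 1)) F

/-! ### The operators `(deg + d)⁻¹` -/

/-- The eigenvalue of `(deg + d)⁻¹` on a basis element.  A basis element of sign `+` has degree
`2l` and one of sign `-` has degree `-2l - 2`; the elements of sign `+` with `2l + d ≤ 0` and those
of sign `-` with `2l + 2 - d ≤ 0` are discarded. -/
def degInvCoeff (d : ℤ) : Idx → ℂ
  | (true, ⟨L, _⟩) => if 0 < (L : ℤ) + d then 1 / ((L : ℂ) + (d : ℂ)) else 0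
  | (false, ⟨L, _⟩) => if 0 < (L : ℤ) + 2 - d then -(1 / ((L : ℂ) + 2 - (d : ℂ))) else 0

/-- `(deg + d)⁻¹` in the variable `Z₁`. -/
def degInv₁ (d : ℤ) (F : Arr) : Arr := fun i j => degInvCoeff d i * F i j

/-- `(deg + d)⁻¹` in the variable `Z₂`. -/
def degInv₂ (d : ℤ) (F : Arr) : Arr := fun i j => degInvCoeff d j * F i j

/-! ### The actions of `𝔤𝔩(2, ℍ_ℂ)` -/

/-- An element `(A B; C D)` of `𝔤𝔩(2, ℍ_ℂ)`. -/
structure GL2H where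
  A : HC
  B : HC
  C : HC
  D : HC

/-- The derivative of `φ` along the vector field of the conformal action
`Z ↦ (aZ + b)(cZ + d)⁻¹` of `exp(-sX)`, at `s = 0`. -/
def fieldDeriv (X : GL2H) (φ : HC → ℂ) (Z : HC) : ℂ :=
  deriv (fun s : ℂ => φ (Z + s • (Z * (X.C * Z + X.D) - X.A * Z - X.B))) 0

/-- The action `π⁰_l`: the differential of
`(π⁰_l(h)φ)(Z) = N(cZ + d)⁻¹ φ((aZ + b)(cZ + d)⁻¹)`, `h⁻¹ = (a b; c d)`. -/
def piL (X : GL2H) (φ : HC → ℂ) (Z : HC) : ℂ :=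
  fieldDeriv X φ Z + (X.C * Z + X.D).trace * φ Z

/-- The action `π⁰_r`: the differential of
`(π⁰_r(h)φ)(Z) = N(a' - Zc')⁻¹ φ((a' - Zc')⁻¹(-b' + Zd'))`, `h = (a' b'; c' d')`. -/
def piR (X : GL2H) (φ : HC → ℂ) (Z : HC) : ℂ :=
  fieldDeriv X φ Z - (X.A - Z * X.C).trace * φ Z

/-- `M` is the matrix of the operator `T` in the harmonic basis. -/
def IsMatrixOf (T : (HC → ℂ) → HC → ℂ) (M : Idx → Idx →₀ ℂ) : Prop :=
  ∀ (i : Idx) (Z : HC), Z.det ≠ 0 →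
    T (basisFn i) Z = (M i).sum fun k c => c * basisFn k Z

/-- `G` is obtained from `F` by applying `T` termwise in the variable `Z₁`. -/
def IsAct₁ (T : (HC → ℂ) → HC → ℂ) (F G : Arr) : Prop :=
  ∃ M : Idx → Idx →₀ ℂ, IsMatrixOf T M ∧ ∀ k j, G k j = ∑ᶠ i : Idx, F i j * M i k

/-- `G` is obtained from `F` by applying `T` termwise in the variable `Z₂`. -/
def IsAct₂ (T : (HC → ℂ) → HC → ℂ) (F G : Arr) : Prop :=
  ∃ M : Idx → Idx →₀ ℂ, IsMatrixOf T M ∧ ∀ i k, G i k = ∑ᶠ j : Idx, F i j * M j k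

/-! ### The space `Ж` and the map `I : Ж → 𝓗𝓗` -/

/-- The space `Ж = ℂ[z₁₁, z₁₂, z₂₁, z₂₂, N(Z)⁻¹]` of polynomial functions on `ℍ_ℂ^×`. -/
def Zh : Subalgebra ℂ (HCx → ℂ) :=
  Algebra.adjoin ℂ
    (insert (fun Z : HCx => (Z : HC).det⁻¹)
      (Set.range fun ij : Fin 2 × Fin 2 => fun Z : HCx => (Z : HC) ij.1 ij.2))

/-- The element `N(Z)⁻¹` of `Ж`. -/
def NInv : Zh :=
  ⟨fun Z : HCx => (Z : HC).det⁻¹, Algebra.subset_adjoin (Set.mem_insert _ _)⟩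

open Classical in
/-- The value of `f ∈ Ж` at a matrix `W` (used only for invertible `W`). -/
def evalZh (f : Zh) (W : HC) : ℂ :=
  if h : IsUnit W then (f : HCx → ℂ) h.unit else 0

/-- `∫_{U(2)_R} g dV`, where `dV = dz⁰ ∧ dz¹ ∧ dz² ∧ dz³` and `U(2)_R = R · U(2)`.
Under the parametrization `W = R e^{iθ} X`, `0 ≤ θ < π`, `X ∈ SU(2)`, of `U(2)_R`, the form `dV`
becomes `±i (R e^{iθ})⁴ dθ dS`; the orientation of `U(2)_R` is the one giving the sign `-`, that is
`(i/2π³) ∫_{U(2)_R} N(W)⁻² dV = 1`. -/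
def intU2 (R : ℝ) (g : HC → ℂ) : ℂ :=
  -Complex.I * ∫ θ in (0 : ℝ)..Real.pi,
    ((R : ℂ) * Complex.exp (Complex.I * (θ : ℂ))) ^ 4 *
      intSU2 (fun X => g (((R : ℂ) * Complex.exp (Complex.I * (θ : ℂ))) • X))

/-- The integral `(I_R f)(Z₁, Z₂) = (i/2π³) ∫_{U(2)_R} f(W) N(W - Z₁)⁻¹ N(W - Z₂)⁻¹ dV`. -/
def IR (R : ℝ) (f : Zh) (Z₁ Z₂ : HC) : ℂ :=
  (Complex.I / (2 * (Real.pi : ℂ) ^ 3)) *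
    intU2 R (fun W => evalZh f W / ((W - Z₁).det * (W - Z₂).det))

/-- The open domains `𝔻⁺_R = {Z ; Z Z* < R²}` (sign `true`) and `𝔻⁻_R = {Z ; Z Z* > R²}`
(sign `false`). -/
def DR : Bool → ℝ → Set HC
  | true, R => {Z | (((R : ℂ) ^ 2) • (1 : HC) - Z * Zᴴ).PosDef}
  | false, R => {Z | (Z * Zᴴ - ((R : ℂ) ^ 2) • (1 : HC)).PosDef}

/-- `a` is the array of coefficients of an element of `𝓗^ε ⊗ 𝓗^ε` that coincides with `I_R f` on
`𝔻^ε_R × 𝔻^ε_R` for all `R > 0`. -/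
def IsSamePart (ε : Bool) (f : Zh) (a : Lab × Lab →₀ ℂ) : Prop :=
  ∀ R : ℝ, 0 < R → ∀ Z₁ ∈ DR ε R, ∀ Z₂ ∈ DR ε R,
    IR R f Z₁ Z₂ = a.sum fun p c => c * basisFn (ε, p.1) Z₁ * basisFn (ε, p.2) Z₂

open Classical in
/-- The maps `I⁺⁺` (`ε = true`) and `I⁻⁻` (`ε = false`). -/
def samePart (ε : Bool) (f : Zh) : Lab × Lab →₀ ℂ :=
  if h : ∃ a, IsSamePart ε f a then h.choose else 0

/-- The coefficients of `I⁺⁻(f)` and `I⁻⁺(f)`: the coefficient at the `i`-th basis function of `Z₁`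
and the `j`-th basis function of `Z₂` (of opposite signs) is `(i/2π³) ∫_{U(2)_R} f(W) ψ_i(W) ψ_j(W)
dV`, where `ψ` is the basis function with the same label and the opposite sign.  The integral does
not depend on `R`; here `R = 1`. -/
def mixedCoeff (f : Zh) (i j : Idx) : ℂ :=
  (Complex.I / (2 * (Real.pi : ℂ) ^ 3)) *
    intU2 1 (fun W => evalZh f W * basisFn (!i.1, i.2) W * basisFn (!j.1, j.2) W)

/-- The map `I = I⁺⁺ - (I⁺⁻ + I⁻⁺) + I⁻⁻ : Ж → 𝓗𝓗`. -/
def mapI (f : Zh) : Arr := fun i j =>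
  if i.1 = j.1 then samePart i.1 f (i.2, j.2) else -mixedCoeff f i j

/-! ### The space `𝓗𝓗^ω` -/

/-- `S` contains `𝓗 ⊗ 𝓗` and `I(Ж)` and is stable under all the operators `(deg + d)⁻¹` in `Z₁` and
in `Z₂` and under the actions `π⁰_l ⊗ 1` and `1 ⊗ π⁰_r` of `𝔤𝔩(2, ℍ_ℂ)`. -/
structure IsOmegaClosed (S : Submodule ℂ Arr) : Prop where
  finite_mem : ∀ F : Arr, {p : Idx × Idx | F p.1 p.2 ≠ 0}.Finite → F ∈ S
  mapI_mem : ∀ f : Zh, mapI f ∈ S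
  degInv₁_mem : ∀ (d : ℤ), ∀ F ∈ S, degInv₁ d F ∈ S
  degInv₂_mem : ∀ (d : ℤ), ∀ F ∈ S, degInv₂ d F ∈ S
  act₁_mem : ∀ (X : GL2H), ∀ F ∈ S, ∀ G, IsAct₁ (piL X) F G → G ∈ S
  act₂_mem : ∀ (X : GL2H), ∀ F ∈ S, ∀ G, IsAct₂ (piR X) F G → G ∈ S

/-- The subspace `𝓗𝓗^ω` of `𝓗𝓗`. -/
def HHω : Submodule ℂ Arr := HH ⊓ sInf {S | IsOmegaClosed S}

/-! ### Realization by analytic functions -/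

/-- Pairs `(Z₁, Z₂) ∈ ℍ_ℂ^× × ℍ_ℂ^×` such that no eigenvalue of `Z₁ Z₂⁻¹` is a positive real
number. -/
def Ω : Set (HC × HC) :=
  {P | P.1.det ≠ 0 ∧ P.2.det ≠ 0 ∧
    ∀ z ∈ spectrum ℂ (P.1 * P.2⁻¹), ¬ ∃ r : ℝ, 0 < r ∧ z = (r : ℂ)}

/-- `Λ⁺` (`true`): both eigenvalues of `Z₁ Z₂⁻¹` lie in the upper half plane;
`Λ⁻` (`false`): both lie in the lower half plane. -/
def Λ : Bool → Set (HC × HC)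
  | true => {P | P.1.det ≠ 0 ∧ P.2.det ≠ 0 ∧ ∀ z ∈ spectrum ℂ (P.1 * P.2⁻¹), 0 < z.im}
  | false => {P | P.1.det ≠ 0 ∧ P.2.det ≠ 0 ∧ ∀ z ∈ spectrum ℂ (P.1 * P.2⁻¹), z.im < 0}

/-- The finite sum of all terms of the series `F` with signs `ε`, `ε'` and given `2l = L`,
`2l' = L'`. -/
def blockSum (F : Arr) (ε ε' : Bool) (L L' : ℕ) (P : HC × HC) : ℂ :=
  ∑ p : Fin (L + 1) × Fin (L + 1), ∑ q : Fin (L' + 1) × Fin (L' + 1),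
    F (ε, ⟨L, p⟩) (ε', ⟨L', q⟩) * basisFn (ε, ⟨L, p⟩) P.1 * basisFn (ε', ⟨L', q⟩) P.2

/-- For opposite signs: the corresponding part of the series `F` (summed first over `m, n, m', n'`,
then over `l, l'`) converges on `𝔻^ε_R × 𝔻^{ε'}_R` for every `R > 0`, and `G` is its analytic
extension to `Ω`. -/
def IsExtension (F : Arr) (ε ε' : Bool) (G : HC × HC → ℂ) : Prop :=
  AnalyticOnNhd ℂ G Ω ∧
  ∀ R : ℝ, 0 < R → ∀ P ∈ Ω, P.1 ∈ DR ε R → P.2 ∈ DR ε' R →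
    HasSum (fun LL : ℕ × ℕ => blockSum F ε ε' LL.1 LL.2 P) (G P)

/-- The part of `F` with both signs equal to `ε` (a finite sum for `F ∈ 𝓗𝓗`), as a function. -/
def finitePart (F : Arr) (ε : Bool) (P : HC × HC) : ℂ :=
  ∑ᶠ p : Lab × Lab, F (ε, p.1) (ε, p.2) * basisFn (ε, p.1) P.1 * basisFn (ε, p.2) P.2

/-- `G` is the realization of the formal series `F` as an analytic function on `Ω`. -/
def IsRealization (F : Arr) (G : HC × HC → ℂ) : Prop :=
  ∃ G₁ G₂ : HC × HC → ℂ, IsExtension F true false G₁ ∧ IsExtension F false true G₂ ∧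
    ∀ P ∈ Ω, G P = finitePart F true P + G₁ P + G₂ P + finitePart F false P

/-! ### Extendable elements and diagonal limits -/

/-- `F ∈ 𝓗𝓗^ω` is extendable: near each diagonal point the restrictions of (the realization of) `F`
to `Λ⁺` and to `Λ⁻` extend analytically across the diagonal. -/
def IsExtendable (F : Arr) : Prop :=
  F ∈ HHω ∧ ∃ G, IsRealization F G ∧
    ∀ Z₀ : HCx, ∃ V : Set (HC × HC), IsOpen V ∧ ((Z₀ : HC), (Z₀ : HC)) ∈ V ∧
      (∀ P ∈ V, P.1.det ≠ 0 ∧ P.2.det ≠ 0) ∧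
      ∀ s : Bool, ∃ g : HC × HC → ℂ, AnalyticOnNhd ℂ g V ∧ ∀ P ∈ Λ s ∩ V, G P = g P

/-- `Diag^s F = φ`: for every `Z ∈ ℍ_ℂ^×` the limit of `F(Z₁, Z₂)` as `Z₁, Z₂ → Z` with
`(Z₁, Z₂) ∈ Λ^s` exists and equals `φ(Z)`. -/
def HasDiag (s : Bool) (F : Arr) (φ : HCx → ℂ) : Prop :=
  ∃ G, IsRealization F G ∧
    ∀ Z : HCx, Tendsto G (𝓝[Λ s] ((Z : HC), (Z : HC))) (𝓝 (φ Z))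

/-- `h = f ∗^s g` in `Ж`: the convolution `I(f) ∗ I(g)` is extendable and
`Diag^s (I(f) ∗ I(g)) = h`. -/
def IsProd (s : Bool) (f g h : Zh) : Prop :=
  IsExtendable (conv (mapI f) (mapI g)) ∧ HasDiag s (conv (mapI f) (mapI g)) (h : HCx → ℂ)

/-- `κ_n^+ = (2πi)^{n-1} B_{n-1}(0) / (n-1)!` for `n ≥ 1`. -/
def kappaPlus (n : ℕ) : ℂ :=
  (2 * (Real.pi : ℂ) * Complex.I) ^ (n - 1) *
    (((Polynomial.bernoulli (n - 1)).eval 0 : ℚ) : ℂ) / ((n - 1).factorial : ℂ)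

/-- `κ_n^- = (2πi)^{n-1} B_{n-1}(1) / (n-1)!` for `n ≥ 1`. -/
def kappaMinus (n : ℕ) : ℂ :=
  (2 * (Real.pi : ℂ) * Complex.I) ^ (n - 1) *
    (((Polynomial.bernoulli (n - 1)).eval 1 : ℚ) : ℂ) / ((n - 1).factorial : ℂ)

end QuatAlg

end

noncomputable section

namespace QuatAlg

/-! ### Matrix coefficients: algebra -/

section MatrixCoefficients

open Polynomial

/-! On `SU(2)` the functions `tCoeff` are the matrix coefficients of its irreducible
representations. Schur orthogonality makes the pairing take the values 1 and -1 on dual labels and 0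
elsewhere (`pairing_eq`). The equal-sign parts of I(N⁻¹) vanish: for fixed X in `SU(2)` the
integrand in W = wX is holomorphic inside or outside the circle |w| = R, so the mean value property
evaluates it (`integral_kerIR`). The mixed parts of I(N⁻¹) live on dual labels with coefficients
-1/(2l+1). Convolution with I(N⁻¹) is therefore (deg+1)⁻¹, and its (k+1)-st power has coefficients
±1/(2l+1)^(k+1) on dual labels (`nConv_NInv`).

To sum these series, write 1/(L+1)^(k+1) as (1/k!)∫ x^k e^{-(L+1)x} dx over x > 0, and use the
generating function Σ r^L χ_L(M) = det(1 - rM)⁻¹ of the characters. The two mixed parts become the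
two halves of one integral over the real line (`hasSum_halfInt`, `kerInt_eq_add_halfInt`), G(Z₁,Z₂)
= -(1/k!) ∫ (-x)^k det(e^{-x/2}Z₂ - e^{x/2}Z₁)⁻¹ dx. It is analytic on Ω, where no positive multiple
of Z₂ makes the determinant vanish.

Near the diagonal this integral becomes singular, but on Λ^± the line of integration can be moved
from Im x = 0 to Im x = ±π: the zeros of the determinant satisfy e^{-x} = eigenvalue of Z₁Z₂⁻¹, and
e^{-x} stays in the other closed half plane (`kerInt_shift`). On the shifted line the minus sign
between Z₂ and Z₁ becomes a plus, so the new integral is analytic across the diagonal. At Z₁ = Z₂ =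
Z it equals N(Z)⁻¹ times a shifted moment of the logistic density, divided by k!. A contour argument
and the binomial theorem give these moments the recurrence of the Bernoulli numbers
(`moment_neg_pi_I`, `moment_pi_I`).

Associativity fails on the triple N⁻¹, N⁻¹, 1: N⁻¹ ∗ 1 = 1, while (N⁻¹ ∗ N⁻¹) ∗ 1 = ∓πi. -/

lemma sum_coeff_mul_linear (a b : ℂ[X]) (u v : ℂ) (N : ℕ) (P : ℂ[X]) (hP : P.natDegree ≤ N) :
    ∑ r ∈ Finset.range (N + 2), C ((P * (C u * X + C v)).coeff r) * a ^ r * b ^ (N + 1 - r) =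
      (C u * a + C v * b) *
        ∑ r ∈ Finset.range (N + 1), C (P.coeff r) * a ^ r * b ^ (N - r) := by
  have hc : P * (C u * X + C v) = C u * (P * X) + C v * P := by ring
  have h1 : ∑ r ∈ Finset.range (N + 2), C ((C u * (P * X)).coeff r) * a ^ r * b ^ (N + 1 - r) =
      C u * a * ∑ r ∈ Finset.range (N + 1), C (P.coeff r) * a ^ r * b ^ (N - r) := by
    rw [Finset.sum_range_succ', Finset.mul_sum]
    simp only [coeff_C_mul, coeff_mul_X, coeff_mul_X_zero, mul_zero, map_zero, zero_mul, add_zero,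
      Nat.add_sub_add_right, C_mul]
    exact Finset.sum_congr rfl fun r _ => by ring
  have h2 : ∑ r ∈ Finset.range (N + 2), C ((C v * P).coeff r) * a ^ r * b ^ (N + 1 - r) =
      C v * b * ∑ r ∈ Finset.range (N + 1), C (P.coeff r) * a ^ r * b ^ (N - r) := by
    rw [Finset.sum_range_succ, Finset.mul_sum]
    have : P.coeff (N + 1) = 0 := coeff_eq_zero_of_natDegree_lt (by omega)
    simp only [coeff_C_mul, this, mul_zero, map_zero, zero_mul, add_zero, C_mul]
    refine Finset.sum_congr rfl fun r hr => ?_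
    rw [show N + 1 - r = N - r + 1 by have := Finset.mem_range.1 hr; omega]
    ring
  rw [hc]
  simp only [coeff_add, map_add, add_mul, Finset.sum_add_distrib]
  rw [h1, h2]

lemma natDegree_linear_pow_mul_le (u v u' v' : ℂ) (q k : ℕ) :
    ((C u * X + C v : ℂ[X]) ^ q * (C u' * X + C v') ^ k).natDegree ≤ q + k := by
  refine natDegree_mul_le.trans (add_le_add ?_ ?_)
  · exact (natDegree_pow_le_of_le q natDegree_linear_le).trans (mul_one q).le
  · exact (natDegree_pow_le_of_le k natDegree_linear_le).trans (mul_one k).le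

/-- Homogenization of a product of linear forms. Taking `a`, `b` to be the linear forms built from
the columns of Z shows that `tMat` is substitution in binary forms, hence multiplicative. -/
lemma sum_coeff_linear_pow (a b : ℂ[X]) (u v u' v' : ℂ) (q k : ℕ) :
    ∑ r ∈ Finset.range (q + k + 1),
      C (((C u * X + C v) ^ q * (C u' * X + C v') ^ k : ℂ[X]).coeff r) * a ^ r * b ^ (q + k - r) =
      (C u * a + C v * b) ^ q * (C u' * a + C v' * b) ^ k := by
  induction k with
  | zero =>
    induction q with
    | zero => simp
    | succ q ih =>
      have := sum_coeff_mul_linear a b u v q ((C u * X + C v) ^ q * (C u' * X + C v') ^ 0)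
        (natDegree_linear_pow_mul_le u v u' v' q 0)
      simp only [pow_zero, mul_one, add_zero] at this ih ⊢
      rw [pow_succ, this, ih]
      ring
  | succ k ih =>
    have := sum_coeff_mul_linear a b u' v' (q + k) ((C u * X + C v) ^ q * (C u' * X + C v') ^ k)
      (natDegree_linear_pow_mul_le u v u' v' q k)
    rw [ih] at this
    rw [show q + (k + 1) + 1 = q + k + 2 by ring, ← add_assoc, pow_succ (C u' * X + C v'),
      ← mul_assoc, this]
    ring

/-- The matrix of the coefficients `t^l_{n m}(Z)`, `2l = L`. -/
def tMat (L : ℕ) (Z : HC) : Matrix (Fin (L + 1)) (Fin (L + 1)) ℂ :=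
  Matrix.of fun p q => tCoeff L p q Z

@[simp] lemma tMat_apply (L : ℕ) (Z : HC) (p q : Fin (L + 1)) : tMat L Z p q = tCoeff L p q Z := rfl

lemma tMat_mul (L : ℕ) (Z W : HC) : tMat L (Z * W) = tMat L Z * tMat L W := by
  ext p q
  simp only [Matrix.mul_apply, tMat_apply]
  have hq : (q : ℕ) + (L - q) = L := by omega
  have h := sum_coeff_linear_pow (C (Z 0 0) * X + C (Z 1 0)) (C (Z 0 1) * X + C (Z 1 1))
    (W 0 0) (W 1 0) (W 0 1) (W 1 1) q (L - q)
  rw [hq] at h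
  have e1 : C ((Z * W) 0 0) * X + C ((Z * W) 1 0) =
      C (W 0 0) * (C (Z 0 0) * X + C (Z 1 0)) + C (W 1 0) * (C (Z 0 1) * X + C (Z 1 1)) := by
    simp only [Matrix.mul_apply, Fin.sum_univ_two, C_add, C_mul]; ring
  have e2 : C ((Z * W) 0 1) * X + C ((Z * W) 1 1) =
      C (W 0 1) * (C (Z 0 0) * X + C (Z 1 0)) + C (W 1 1) * (C (Z 0 1) * X + C (Z 1 1)) := by
    simp only [Matrix.mul_apply, Fin.sum_univ_two, C_add, C_mul]; ring
  rw [tCoeff, e1, e2, ← h, finsetSum_coeff, Finset.sum_range]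
  refine Finset.sum_congr rfl fun r _ => ?_
  rw [mul_assoc, coeff_C_mul, mul_comm]
  rfl

lemma tCoeff_smul (L : ℕ) (p q : Fin (L + 1)) (c : ℂ) (Z : HC) :
    tCoeff L p q (c • Z) = c ^ L * tCoeff L p q Z := by
  have h : ∀ x y : ℂ, C (c * x) * X + C (c * y) = C c * (C x * X + C y) := by
    intro x y; simp only [C_mul]; ring
  simp only [tCoeff, Matrix.smul_apply, smul_eq_mul, h, mul_pow]
  rw [mul_mul_mul_comm, ← pow_add, show (q : ℕ) + (L - q) = L by omega, ← C_pow, coeff_C_mul]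

lemma tCoeff_diagonal (L : ℕ) (p q : Fin (L + 1)) (z w : ℂ) :
    tCoeff L p q !![z, 0; 0, w] = if p = q then z ^ (q : ℕ) * w ^ (L - (q : ℕ)) else 0 := by
  simp only [tCoeff, Matrix.of_apply, Matrix.cons_val', Matrix.cons_val_zero, Matrix.cons_val_one,
    Matrix.cons_val_fin_one, map_zero, add_zero, zero_mul, zero_add, mul_pow, ← C_pow]
  rw [mul_comm, ← mul_assoc, ← C_mul, coeff_C_mul, coeff_X_pow]
  simp only [Fin.ext_iff]
  split_ifs <;> simp [mul_comm]

lemma tMat_one (L : ℕ) : tMat L 1 = 1 := by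
  ext p q
  rw [tMat_apply, Matrix.one_fin_two, tCoeff_diagonal, Matrix.one_apply]
  simp

lemma tCoeff_zero_left (L : ℕ) (q : Fin (L + 1)) (Z : HC) :
    tCoeff L 0 q Z = Z 1 0 ^ (q : ℕ) * Z 1 1 ^ (L - (q : ℕ)) := by
  simp [tCoeff, coeff_zero_eq_eval_zero]

lemma tCoeff_zero_right (L : ℕ) (p : Fin (L + 1)) (Z : HC) :
    tCoeff L p 0 Z = L.choose p * Z 0 1 ^ (p : ℕ) * Z 1 1 ^ (L - (p : ℕ)) := by
  simp only [tCoeff, Fin.val_zero, pow_zero, one_mul, Nat.sub_zero]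
  have h : (C (Z 0 1) * X + C (Z 1 1) : ℂ[X]) ^ L = ∑ b ∈ Finset.range (L + 1),
      C (L.choose b * Z 0 1 ^ b * Z 1 1 ^ (L - b)) * X ^ b := by
    rw [add_pow]
    refine Finset.sum_congr rfl fun b _ => ?_
    simp only [mul_pow, C_mul, C_pow, C_eq_natCast]
    ring
  simp only [h, finsetSum_coeff, coeff_C_mul_X_pow]
  rw [Finset.sum_ite_eq, if_pos (Finset.mem_range.2 p.2)]

lemma tCoeff_upper (L : ℕ) (p : Fin (L + 1)) (Z : HC) (h : Z 1 0 = 0) :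
    tCoeff L p p Z = Z 0 0 ^ (p : ℕ) * Z 1 1 ^ (L - (p : ℕ)) := by
  simp only [tCoeff, h, map_zero, add_zero, mul_pow, ← C_pow]
  rw [mul_assoc, coeff_C_mul, coeff_X_pow_mul', if_pos le_rfl, Nat.sub_self,
    coeff_zero_eq_eval_zero]
  simp

lemma tCoeff_lower (L : ℕ) (p : Fin (L + 1)) (Z : HC) (h : Z 0 1 = 0) :
    tCoeff L p p Z = Z 0 0 ^ (p : ℕ) * Z 1 1 ^ (L - (p : ℕ)) := by
  simp only [tCoeff, h, map_zero, zero_mul, zero_add, ← C_pow]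
  rw [mul_comm, coeff_C_mul, mul_comm]
  congr 1
  have := coeff_pow_of_natDegree_le (m := (p : ℕ)) (natDegree_linear_le (a := Z 0 0) (b := Z 1 0))
  simpa using this

/-- The eigenvalues of a `2 × 2` matrix and the character of `tMat`. -/
lemma exists_eigenvalues (M : HC) : ∃ l₁ l₂ : ℂ, (∀ z : ℂ, (z • (1 : HC) - M).det = (z - l₁) * (z - l₂)) ∧
    ∀ L : ℕ, (tMat L M).trace = ∑ k ∈ Finset.range (L + 1), l₁ ^ k * l₂ ^ (L - k) := by
  have key : ∀ (A : HC) , (∀ L, ∀ p : Fin (L + 1), tCoeff L p p A = A 0 0 ^ (p : ℕ) * A 1 1 ^ (L - (p : ℕ))) →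
      ∀ L : ℕ, (tMat L A).trace = ∑ k ∈ Finset.range (L + 1), A 0 0 ^ k * A 1 1 ^ (L - k) := by
    intro A hA L
    rw [Matrix.trace, ← Fin.sum_univ_eq_sum_range (fun k => A 0 0 ^ k * A 1 1 ^ (L - k))]
    exact Finset.sum_congr rfl fun p _ => hA L p
  by_cases hb : M 0 1 = 0
  · refine ⟨M 0 0, M 1 1, ?_, key M fun L p => tCoeff_lower L p M hb⟩
    intro z
    simp [Matrix.det_fin_two, hb]
  -- The quadratic equation says that (1, c) is an eigenvector of M, so conjugation by the unipotent
  -- matrix `P` makes M upper triangular, and diagonal coefficients of `tMat` can be read off.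
  · obtain ⟨c, hc⟩ : ∃ c : ℂ, M 0 1 * (c * c) + (M 0 0 - M 1 1) * c + -M 1 0 = 0 := by
      obtain ⟨s, hs⟩ := IsAlgClosed.exists_pow_nat_eq (discrim (M 0 1) (M 0 0 - M 1 1) (-M 1 0))
        (n := 2) (by norm_num)
      exact exists_quadratic_eq_zero hb ⟨s, by rw [← hs]; ring⟩
    let P : HC := !![1, 0; c, 1]
    let Q : HC := !![1, 0; -c, 1]
    have hPQ : P * Q = 1 := by
      ext i j; fin_cases i <;> fin_cases j <;> simp [P, Q, Matrix.mul_apply, Fin.sum_univ_two]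
    let U : HC := Q * M * P
    have hU : M = P * U * Q := by
      calc M = (P * Q) * M * (P * Q) := by rw [hPQ]; simp
        _ = P * U * Q := by simp only [U, Matrix.mul_assoc]
    have hQP : Q * P = 1 := mul_eq_one_comm.1 hPQ
    have hU0 : U 1 0 = 0 := by
      simp only [U, P, Q, Matrix.mul_apply, Fin.sum_univ_two, Matrix.of_apply, Matrix.cons_val',
        Matrix.cons_val_zero, Matrix.cons_val_one, Matrix.cons_val_fin_one]
      linear_combination -hc
    refine ⟨U 0 0, U 1 1, ?_, ?_⟩
    · intro z
      have : z • (1 : HC) - M = P * (z • (1 : HC) - U) * Q := by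
        rw [hU, mul_sub, sub_mul, Matrix.mul_smul, Matrix.smul_mul, mul_one, hPQ]
      rw [this, Matrix.det_mul, Matrix.det_mul, mul_right_comm, ← Matrix.det_mul, hPQ]
      simp [Matrix.det_fin_two, hU0]
    · intro L
      rw [← key U (fun L p => tCoeff_upper L p U hU0) L]
      conv_lhs => rw [hU]
      rw [tMat_mul, tMat_mul, Matrix.trace_mul_comm, ← mul_assoc, ← tMat_mul, hQP, tMat_one, one_mul]

end MatrixCoefficients

/-! ### Homogeneity of the basis functions -/

/-- The degree of homogeneity of a basis function. -/
def basisDeg (i : Idx) : ℤ := if i.1 then (i.2.1 : ℤ) else -(i.2.1 : ℤ) - 2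

lemma inv_smul_HC (c : ℂ) (hc : c ≠ 0) (Z : HC) : (c • Z)⁻¹ = c⁻¹ • Z⁻¹ := by
  rw [Matrix.inv_def, Matrix.inv_def, Matrix.det_smul, Matrix.adjugate_smul]
  simp only [Fintype.card_fin, Ring.inverse_eq_inv', mul_inv, smul_smul, Nat.add_one_sub_one, pow_one]
  congr 1
  field_simp

lemma basisFn_smul (i : Idx) (c : ℂ) (hc : c ≠ 0) (Z : HC) :
    basisFn i (c • Z) = c ^ basisDeg i * basisFn i Z := by
  obtain ⟨ε, L, n, m⟩ := i
  cases ε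
  · simp only [basisFn, basisDeg, inv_smul_HC c hc, tCoeff_smul, Matrix.det_smul, Fintype.card_fin, mul_inv,
      inv_pow, Bool.false_eq_true, if_false]
    rw [show (-(L : ℤ) - 2) = -((L + 2 : ℕ) : ℤ) by push_cast; ring, zpow_neg, zpow_natCast, pow_add]
    simp only [mul_inv]
    ring
  · simp [basisFn, basisDeg, tCoeff_smul]

lemma degTilde_basisFn (i : Idx) (Z : HC) :
    degTilde (basisFn i) Z = (basisDeg i + 1) * basisFn i Z := by
  -- Homogeneity is available only for s ≠ 0, which suffices for the derivative at s = 1.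
  have h : (fun s : ℂ => basisFn i (s • Z)) =ᶠ[𝓝 1] fun s => s ^ basisDeg i * basisFn i Z := by
    filter_upwards [isOpen_ne.mem_nhds (one_ne_zero (α := ℂ))] with s hs
    exact basisFn_smul i s hs Z
  rw [degTilde, h.deriv_eq, deriv_mul_const_field, deriv_zpow]
  simp
  ring

/-! ### Positivity -/

/-- A left null vector v would satisfy vB = u·vA, hence |vB| ≤ |vA|, against the positivity of BB* -
AA*. -/
lemma det_sub_smul_ne_zero {A B : HC} (h : (B * Bᴴ - A * Aᴴ).PosDef) {u : ℂ} (hu : ‖u‖ ≤ 1) :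
    (B - u • A).det ≠ 0 := by
  intro h0
  obtain ⟨v, hv, hv0⟩ := Matrix.exists_vecMul_eq_zero_iff.2 h0
  have hBA : v ᵥ* B = u • (v ᵥ* A) := by
    rw [Matrix.vecMul_sub, Matrix.vecMul_smul, sub_eq_zero] at hv0
    exact hv0
  have key : ∀ M : HC, star (star v) ⬝ᵥ ((M * Mᴴ) *ᵥ star v) = (v ᵥ* M) ⬝ᵥ star (v ᵥ* M) := by
    intro M
    rw [star_star, ← Matrix.mulVec_mulVec, ← Matrix.star_vecMul, Matrix.dotProduct_mulVec]
  have hpos := h.dotProduct_mulVec_pos (x := star v) (by simpa using hv)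
  rw [Matrix.sub_mulVec, dotProduct_sub, key, key, hBA, star_smul, smul_dotProduct, dotProduct_smul] at hpos
  have hn := dotProduct_star_self_nonneg (v ᵥ* A)
  rw [Complex.le_def] at hn
  rw [Complex.lt_def] at hpos
  set t := v ᵥ* A ⬝ᵥ star (v ᵥ* A)
  have e : u • star u • t - t = ((‖u‖ ^ 2 - 1 : ℝ) : ℂ) * t := by
    simp only [smul_eq_mul, ← mul_assoc, Complex.star_def, Complex.mul_conj, Complex.normSq_eq_norm_sq]
    push_cast; ring
  rw [e, Complex.re_ofReal_mul] at hpos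
  have h1 : ‖u‖ ^ 2 ≤ 1 := by nlinarith [norm_nonneg u]
  have h2 : 0 ≤ t.re := by rw [dotProduct_comm] at hn; exact hn.1
  have := hpos.1
  simp only [Complex.zero_re] at this
  nlinarith

/-! ### Integration over `SU(2)` -/

/-- The quaternion with the given coordinates, as a complex matrix. -/
def toHC (x : EuclideanSpace ℝ (Fin 4)) : HC :=
  !![(x 0 : ℂ) - Complex.I * (x 3 : ℂ), -Complex.I * (x 1 : ℂ) - (x 2 : ℂ);
     -Complex.I * (x 1 : ℂ) + (x 2 : ℂ), (x 0 : ℂ) + Complex.I * (x 3 : ℂ)]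

lemma toSU2_eq (x : S3) : toSU2 x = toHC x.1 := rfl

/-- Left multiplication by a quaternion. -/
def quatMul (a : EuclideanSpace ℝ (Fin 4)) : EuclideanSpace ℝ (Fin 4) →ₗ[ℝ] EuclideanSpace ℝ (Fin 4) where
  toFun b := !₂[a 0 * b 0 - a 1 * b 1 - a 2 * b 2 - a 3 * b 3,
    a 0 * b 1 + a 1 * b 0 + a 2 * b 3 - a 3 * b 2,
    a 0 * b 2 - a 1 * b 3 + a 2 * b 0 + a 3 * b 1,
    a 0 * b 3 + a 1 * b 2 - a 2 * b 1 + a 3 * b 0]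
  map_add' b c := by
    ext i
    fin_cases i <;> simp <;> ring
  map_smul' r b := by
    ext i
    fin_cases i <;> simp <;> ring

lemma toHC_quatMul (a b : EuclideanSpace ℝ (Fin 4)) : toHC (quatMul a b) = toHC a * toHC b := by
  ext i j
  fin_cases i <;> fin_cases j <;>
    simp [toHC, quatMul, Matrix.mul_apply, Fin.sum_univ_two, -Complex.coe_algebraMap] <;> ring_nf <;>
    simp only [Complex.I_sq] <;> ring

lemma norm_sq_four (x : EuclideanSpace ℝ (Fin 4)) :
    ‖x‖ ^ 2 = x 0 ^ 2 + x 1 ^ 2 + x 2 ^ 2 + x 3 ^ 2 := by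
  rw [EuclideanSpace.norm_sq_eq, Fin.sum_univ_four]
  simp

lemma norm_quatMul (a b : EuclideanSpace ℝ (Fin 4)) : ‖quatMul a b‖ = ‖a‖ * ‖b‖ := by
  rw [← sq_eq_sq₀ (norm_nonneg _) (by positivity), mul_pow, norm_sq_four, norm_sq_four, norm_sq_four]
  simp [quatMul]
  ring

lemma sq_sum_S3 (x : S3) : (x.1 0 : ℂ) ^ 2 + (x.1 1 : ℂ) ^ 2 + (x.1 2 : ℂ) ^ 2 + (x.1 3 : ℂ) ^ 2 = 1 := by
  have h := norm_sq_four x.1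
  rw [norm_eq_of_mem_sphere x] at h
  exact_mod_cast h.symm.trans (one_pow 2)

lemma det_toSU2 (x : S3) : (toSU2 x).det = 1 := by
  rw [← sq_sum_S3 x, toSU2, Matrix.det_fin_two_of]
  ring_nf
  simp only [Complex.I_sq]
  ring

lemma toSU2_mul_conjTranspose (x : S3) : toSU2 x * (toSU2 x)ᴴ = 1 := by
  have h := sq_sum_S3 x
  ext i j
  fin_cases i <;> fin_cases j <;>
    simp [toSU2, Matrix.mul_apply, Fin.sum_univ_two] <;> ring_nf <;>
    simp only [Complex.I_sq] <;> linear_combination h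

lemma toSU2_inv (x : S3) : (toSU2 x)⁻¹ = (toSU2 x)ᴴ :=
  Matrix.inv_eq_right_inv (toSU2_mul_conjTranspose x)

lemma continuous_toSU2 : Continuous toSU2 := by
  refine continuous_matrix fun i j => ?_
  have h : ∀ k, Continuous fun x : S3 => (x.1 k : ℂ) := fun k => by fun_prop
  fin_cases i <;> fin_cases j <;> simp [toSU2] <;> fun_prop

open scoped Pointwise in
/-- The measure on the unit sphere is invariant under linear isometries. -/
lemma integral_toSphere_comp_isometry {E : Type*} [NormedAddCommGroup E] [InnerProductSpace ℝ E]
    [FiniteDimensional ℝ E] [MeasurableSpace E] [BorelSpace E] (A : E ≃ₗᵢ[ℝ] E)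
    (f : E → ℂ) :
    ∫ x : Metric.sphere (0 : E) 1, f (A x) ∂(volume : Measure E).toSphere =
      ∫ x : Metric.sphere (0 : E) 1, f x ∂(volume : Measure E).toSphere := by
  let φ : Metric.sphere (0 : E) 1 → Metric.sphere (0 : E) 1 := fun x => ⟨A x, by simp⟩
  have hφ : Continuous φ := by fun_prop
  have hinj : Function.Injective φ := fun x y h =>
    Subtype.ext (A.injective (congrArg Subtype.val h))
  have hpre : MeasurePreserving φ (volume : Measure E).toSphere (volume : Measure E).toSphere := by
    refine ⟨hφ.measurable, ?_⟩
    ext s hs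
    -- The sphere measure is a multiple of the volume of the cone over a set, and a linear isometry
    -- carries cones to cones and preserves volume.
    rw [Measure.map_apply hφ.measurable hs, Measure.toSphere_apply' _ hs,
      Measure.toSphere_apply' _ (hφ.measurable hs),
      ← A.measurePreserving.measure_preimage_equiv (f := A.toHomeomorph.toMeasurableEquiv)
        (Set.Ioo (0 : ℝ) 1 • (Subtype.val '' s))]
    congr 2
    ext v
    simp only [Set.mem_smul, Set.mem_image, Set.mem_preimage]
    constructor
    · rintro ⟨r, hr, _, ⟨x, hx, rfl⟩, rfl⟩
      exact ⟨r, hr, _, ⟨φ x, hx, rfl⟩, (map_smul A r (x : E)).symm⟩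
    · rintro ⟨r, hr, _, ⟨x, hx, rfl⟩, hv⟩
      have hx' : A.symm (x : E) ∈ Metric.sphere (0 : E) 1 := by simp
      refine ⟨r, hr, _, ⟨⟨A.symm x, hx'⟩, ?_, rfl⟩, ?_⟩
      · have : φ ⟨A.symm x, hx'⟩ = x := Subtype.ext (A.apply_symm_apply _)
        rwa [this]
      · apply A.injective
        simpa using hv
  exact hpre.integral_comp (hφ.measurableEmbedding hinj) fun x => f x

/-- Left multiplication by a unit quaternion is a linear isometry of ℝ⁴. -/
lemma intSU2_mul_left (y : S3) (g : HC → ℂ) :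
    intSU2 (fun X => g (toSU2 y * X)) = intSU2 g := by
  have hy : ‖y.1‖ = 1 := norm_eq_of_mem_sphere y
  let A₀ : EuclideanSpace ℝ (Fin 4) →ₗᵢ[ℝ] EuclideanSpace ℝ (Fin 4) :=
    ⟨quatMul y.1, fun b => by rw [norm_quatMul, hy, one_mul]⟩
  let A := A₀.toLinearIsometryEquiv rfl
  have h := integral_toSphere_comp_isometry A fun v => g (toHC v)
  unfold intSU2
  simp only [toSU2_eq, ← toHC_quatMul]
  exact h

/-- The unit quaternion with given coordinates. -/
def mkS3 (v : EuclideanSpace ℝ (Fin 4)) (h : v 0 ^ 2 + v 1 ^ 2 + v 2 ^ 2 + v 3 ^ 2 = 1) : S3 :=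
  ⟨v, by
    rw [mem_sphere_zero_iff_norm, ← sq_eq_sq₀ (norm_nonneg _) zero_le_one, norm_sq_four, h, one_pow]⟩

lemma intSU2_neg (g : HC → ℂ) : intSU2 (fun X => g (-X)) = intSU2 g := by
  let y : S3 := mkS3 !₂[-1, 0, 0, 0] (by simp)
  have hy : toSU2 y = -1 := by
    ext i j
    fin_cases i <;> fin_cases j <;> simp [toSU2, y, mkS3]
  rw [← intSU2_mul_left y g, hy]
  simp

lemma toSphere_real_S3 :
    ((volume : Measure (EuclideanSpace ℝ (Fin 4))).toSphere).real Set.univ = 2 * Real.pi ^ 2 := by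
  rw [Measure.toSphere_real_apply_univ, measureReal_def, EuclideanSpace.volume_ball]
  have : Real.Gamma (4 / 2 + 1) = 2 := by
    rw [show (4 / 2 + 1 : ℝ) = (2 : ℕ) + 1 by norm_num, Real.Gamma_nat_eq_factorial]; norm_num
  simp [this]
  rw [show (4 : ℕ) = 2 * 2 by norm_num, pow_mul, Real.sq_sqrt Real.pi_pos.le]
  rw [ENNReal.toReal_ofReal (by positivity)]
  ring

lemma intSU2_const (c : ℂ) : intSU2 (fun _ => c) = 2 * (Real.pi : ℂ) ^ 2 * c := by
  rw [intSU2, integral_const, toSphere_real_S3, Complex.real_smul]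
  push_cast
  ring

lemma integrable_S3 {g : S3 → ℂ} (hg : Continuous g) :
    Integrable g ((volume : Measure (EuclideanSpace ℝ (Fin 4))).toSphere) :=
  hg.integrable_of_hasCompactSupport (HasCompactSupport.of_compactSpace g)

lemma intSU2_congr {g h : HC → ℂ} (hgh : ∀ x : S3, g (toSU2 x) = h (toSU2 x)) :
    intSU2 g = intSU2 h :=
  integral_congr_ae (Eventually.of_forall hgh)

lemma intSU2_const_mul (c : ℂ) (g : HC → ℂ) : intSU2 (fun X => c * g X) = c * intSU2 g :=
  integral_const_mul c _

lemma intSU2_sum {ι : Type*} (s : Finset ι) (g : ι → HC → ℂ)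
    (hg : ∀ i ∈ s, Continuous fun x : S3 => g i (toSU2 x)) :
    intSU2 (fun X => ∑ i ∈ s, g i X) = ∑ i ∈ s, intSU2 (g i) :=
  integral_finsetSum s fun i hi => integrable_S3 (hg i hi)

/-! ### Continuity of the matrix coefficients, for integrability on the sphere -/

section Continuity

open Polynomial

lemma continuous_coeff_mul {P Q : HC → ℂ[X]} (hP : ∀ r, Continuous fun Z => (P Z).coeff r)
    (hQ : ∀ r, Continuous fun Z => (Q Z).coeff r) (r : ℕ) :
    Continuous fun Z => (P Z * Q Z).coeff r := by
  simp only [coeff_mul]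
  exact continuous_finsetSum _ fun i _ => (hP _).mul (hQ _)

lemma continuous_coeff_pow {P : HC → ℂ[X]} (hP : ∀ r, Continuous fun Z => (P Z).coeff r)
    (k r : ℕ) : Continuous fun Z => (P Z ^ k).coeff r := by
  induction k generalizing r with
  | zero => simpa using continuous_const
  | succ k ih =>
    simp only [pow_succ]
    exact continuous_coeff_mul ih hP r

lemma continuous_tCoeff (L : ℕ) (p q : Fin (L + 1)) : Continuous (tCoeff L p q) := by
  have h : ∀ j, ∀ r, Continuous fun Z : HC => (C (Z 0 j) * X + C (Z 1 j) : ℂ[X]).coeff r := by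
    intro j r
    have h0 : Continuous fun Z : HC => Z 0 j := continuous_id.matrix_elem 0 j
    have h1 : Continuous fun Z : HC => Z 1 j := continuous_id.matrix_elem 1 j
    simp only [coeff_add, coeff_C_mul, coeff_C]
    refine (h0.mul continuous_const).add ?_
    split_ifs
    · exact h1
    · exact continuous_const
  exact continuous_coeff_mul (continuous_coeff_pow (h 0) _) (continuous_coeff_pow (h 1) _) _

end Continuity

lemma continuous_basisFn_toSU2 (i : Idx) : Continuous fun x : S3 => basisFn i (toSU2 x) := by
  obtain ⟨ε, L, n, m⟩ := i
  cases ε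
  · simp only [basisFn, det_toSU2, toSU2_inv]
    exact continuous_const.mul ((continuous_tCoeff L m n).comp continuous_toSU2.matrix_conjTranspose)
  · exact (continuous_tCoeff L n m).comp continuous_toSU2

/-! ### Schur orthogonality -/

/-- The averaged intertwiner attached to a pair of matrix coefficients. -/
def avgMat (L L' : ℕ) (q : Fin (L + 1)) (q' : Fin (L' + 1)) :
    Matrix (Fin (L + 1)) (Fin (L' + 1)) ℂ :=
  Matrix.of fun p p' => intSU2 fun X => tCoeff L p q X * tCoeff L' q' p' X⁻¹

lemma continuous_tCoeff_mul (L L' : ℕ) (p q : Fin (L + 1)) (q' p' : Fin (L' + 1)) :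
    Continuous fun x : S3 => tCoeff L p q (toSU2 x) * tCoeff L' q' p' (toSU2 x)⁻¹ := by
  simp only [toSU2_inv]
  exact ((continuous_tCoeff L p q).comp continuous_toSU2).mul
    ((continuous_tCoeff L' q' p').comp continuous_toSU2.matrix_conjTranspose)

/-- `avgMat` is the average of t(X) E t(X⁻¹) with E an elementary matrix; replacing X by gX and
using left invariance gives the intertwining property. -/
lemma avgMat_intertwines (L L' : ℕ) (q : Fin (L + 1)) (q' : Fin (L' + 1)) (y : S3) :
    tMat L (toSU2 y) * avgMat L L' q q' = avgMat L L' q q' * tMat L' (toSU2 y) := by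
  set g := toSU2 y
  have hdet : IsUnit g.det := by rw [det_toSU2]; exact isUnit_one
  have hinv : tMat L' g⁻¹ * tMat L' g = 1 := by
    rw [← tMat_mul, Matrix.nonsing_inv_mul _ hdet, tMat_one]
  have h : avgMat L L' q q' = tMat L g * avgMat L L' q q' * tMat L' g⁻¹ := by
    ext p p'
    rw [avgMat, Matrix.of_apply, ← intSU2_mul_left y]
    have e : ∀ X : HC, tCoeff L p q (g * X) * tCoeff L' q' p' (g * X)⁻¹ =
        ∑ r' : Fin (L' + 1), ∑ r : Fin (L + 1),
          tCoeff L p r g * tCoeff L' r' p' g⁻¹ * (tCoeff L r q X * tCoeff L' q' r' X⁻¹) := by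
      intro X
      rw [Matrix.mul_inv_rev, ← tMat_apply, ← tMat_apply, tMat_mul, tMat_mul, Matrix.mul_apply,
        Matrix.mul_apply, Finset.sum_mul_sum, Finset.sum_comm]
      exact Finset.sum_congr rfl fun r' _ => Finset.sum_congr rfl fun r _ => by
        simp only [tMat_apply]; ring
    rw [funext e, intSU2_sum _ _ fun r' _ => continuous_finsetSum _ fun r _ =>
      continuous_const.mul (continuous_tCoeff_mul L L' r q q' r'), Matrix.mul_apply]
    refine Finset.sum_congr rfl fun r' _ => ?_
    rw [intSU2_sum _ _ fun r _ => continuous_const.mul (continuous_tCoeff_mul L L' r q q' r'),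
      Matrix.mul_apply, Finset.sum_mul]
    refine Finset.sum_congr rfl fun r _ => ?_
    rw [intSU2_const_mul]
    simp only [tMat_apply, Matrix.of_apply]
    ring
  calc tMat L g * avgMat L L' q q' = tMat L g * avgMat L L' q q' * (tMat L' g⁻¹ * tMat L' g) := by
        rw [hinv, Matrix.mul_one]
    _ = _ := by rw [← Matrix.mul_assoc, ← h]

/-- An intertwiner preserves weights of the diagonal torus. One torus element suffices: z =
exp(iπ/d), with d the difference of the weights, has z^d = -1, so the entry equals its own negative.
-/
lemma avgMat_weight (L L' : ℕ) (q : Fin (L + 1)) (q' : Fin (L' + 1)) (p : Fin (L + 1))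
    (p' : Fin (L' + 1)) (h : 2 * (p : ℤ) - L ≠ 2 * p' - L') : avgMat L L' q q' p p' = 0 := by
  set d : ℤ := (2 * (p : ℤ) - L) - (2 * p' - L') with hd
  have hd0 : (d : ℂ) ≠ 0 := Int.cast_ne_zero.2 (sub_ne_zero.2 h)
  let θ : ℝ := Real.pi / d
  let z : ℂ := Complex.exp (Complex.I * θ)
  have hz : z = Real.cos θ + Real.sin θ * Complex.I := by
    simp only [z]; rw [mul_comm, Complex.exp_mul_I]; push_cast; rfl
  have hz0 : z ≠ 0 := Complex.exp_ne_zero _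
  have hzi : z⁻¹ = Real.cos θ - Real.sin θ * Complex.I := by
    rw [← Complex.exp_neg, show -(Complex.I * (θ : ℂ)) = -θ * Complex.I by ring, Complex.exp_mul_I,
      Complex.cos_neg, Complex.sin_neg]
    push_cast
    ring
  have hzd : z ^ d = -1 := by
    rw [← Complex.exp_int_mul]
    simp only [θ]
    push_cast
    rw [show (d : ℂ) * (Complex.I * (Real.pi / d)) = Real.pi * Complex.I by field_simp,
      Complex.exp_pi_mul_I]
  let y : S3 := mkS3 !₂[Real.cos θ, 0, 0, -Real.sin θ] (by simp)
  have hy : toSU2 y = !![z, 0; 0, z⁻¹] := by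
    rw [hzi, hz]
    ext i j
    fin_cases i <;> fin_cases j <;> simp [toSU2, y, mkS3] <;> ring
  have H := congrFun (congrFun (avgMat_intertwines L L' q q' y) p) p'
  simp only [Matrix.mul_apply, tMat_apply, hy, tCoeff_diagonal, ite_mul, mul_ite, zero_mul, mul_zero,
    Finset.sum_ite_eq, Finset.sum_ite_eq', Finset.mem_univ, if_true] at H
  have hw : ∀ (N k : ℕ), k ≤ N → z ^ k * z⁻¹ ^ (N - k) = z ^ (2 * (k : ℤ) - N) := by
    intro N k hk
    rw [inv_pow, ← zpow_natCast, ← zpow_natCast, ← zpow_neg, ← zpow_add₀ hz0]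
    congr 1
    omega
  rw [hw L p (by omega), hw L' p' (by omega),
    show 2 * (p : ℤ) - L = d + (2 * p' - L') by rw [hd]; ring, zpow_add₀ hz0, hzd] at H
  have hne : z ^ (2 * (p' : ℤ) - L') ≠ 0 := zpow_ne_zero _ hz0
  have : (2 * z ^ (2 * (p' : ℤ) - L')) * avgMat L L' q q' p p' = 0 := by linear_combination -H
  exact (mul_eq_zero.1 this).resolve_left (mul_ne_zero two_ne_zero hne)

/-- For such an element, row 0 and column 0 of every `tMat` have no zero entry; this replaces
irreducibility in the two lemmas below. -/
lemma exists_toSU2_generic : ∃ y : S3, ∀ i j, toSU2 y i j ≠ 0 := by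
  refine ⟨mkS3 !₂[1 / 2, 1 / 2, 1 / 2, 1 / 2] (by simp; norm_num), fun i j h => ?_⟩
  have h1 := congrArg Complex.re h
  fin_cases i <;> fin_cases j <;> simp [toSU2, mkS3] at h1

/-- The extreme weight of the larger representation does not occur in the smaller one. Comparing the
intertwining relation in column 0 (if L < L') or row 0 (if L' < L) leaves a single term, with
nonzero coefficient. -/
lemma avgMat_of_ne {L L' : ℕ} (hL : L ≠ L') (q : Fin (L + 1)) (q' : Fin (L' + 1)) :
    avgMat L L' q q' = 0 := by
  obtain ⟨y, hy⟩ := exists_toSU2_generic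
  have H := avgMat_intertwines L L' q q' y
  ext p p'
  by_cases hw : 2 * (p : ℤ) - L ≠ 2 * p' - L'
  · exact avgMat_weight L L' q q' p p' hw
  push Not at hw
  rcases lt_or_gt_of_ne hL with h | h
  · have H0 := congrFun (congrFun H p) 0
    rw [Matrix.mul_apply, Finset.sum_eq_zero fun r _ => ?_, Matrix.mul_apply,
      Finset.sum_eq_single p' ?_ (by simp)] at H0
    · rw [tMat_apply, tCoeff_zero_right] at H0
      refine (mul_eq_zero.1 H0.symm).resolve_right ?_
      have : ((L'.choose p' : ℕ) : ℂ) ≠ 0 := by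
        exact_mod_cast (Nat.choose_pos (by omega)).ne'
      exact mul_ne_zero (mul_ne_zero this (pow_ne_zero _ (hy 0 1))) (pow_ne_zero _ (hy 1 1))
    · intro r _ hr
      rw [avgMat_weight L L' q q' p r fun h' => hr (Fin.ext (by omega)), zero_mul]
    · rw [avgMat_weight L L' q q' r 0 (by simp; omega), mul_zero]
  · have H0 := congrFun (congrFun H 0) p'
    rw [eq_comm, Matrix.mul_apply, Finset.sum_eq_zero fun r _ => ?_, Matrix.mul_apply,
      Finset.sum_eq_single p ?_ (by simp)] at H0
    · rw [tMat_apply, tCoeff_zero_left] at H0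
      exact (mul_eq_zero.1 H0.symm).resolve_left
        (mul_ne_zero (pow_ne_zero _ (hy 1 0)) (pow_ne_zero _ (hy 1 1)))
    · intro r _ hr
      rw [avgMat_weight L L' q q' r p' fun h' => hr (Fin.ext (by omega)), mul_zero]
    · rw [avgMat_weight L L' q q' 0 r (by simp; omega), zero_mul]

/-- Schur's lemma by hand: weights make the intertwiner diagonal, row 0 at a generic element makes
it scalar, and t(X⁻¹)t(X) = 1 gives its trace. -/
lemma avgMat_same (L : ℕ) (q q' p p' : Fin (L + 1)) :
    avgMat L L q q' p p' = if p = p' ∧ q = q' then 2 * (Real.pi : ℂ) ^ 2 / (L + 1) else 0 := by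
  by_cases hp : p = p'
  swap
  · rw [if_neg fun h => hp h.1]
    exact avgMat_weight L L q q' p p' fun h => hp (Fin.ext (by omega))
  subst hp
  obtain ⟨y, hy⟩ := exists_toSU2_generic
  have H := avgMat_intertwines L L q q' y
  have hoff : ∀ r r' : Fin (L + 1), r ≠ r' → avgMat L L q q' r r' = 0 := fun r r' hr =>
    avgMat_weight L L q q' r r' fun h => hr (Fin.ext (by omega))
  have hdiag : ∀ r, avgMat L L q q' r r = avgMat L L q q' 0 0 := by
    intro r
    have H0 := congrFun (congrFun H 0) r
    rw [Matrix.mul_apply, Matrix.mul_apply,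
      Finset.sum_eq_single r (fun b _ hb => by rw [hoff b r hb, mul_zero]) (by simp),
      Finset.sum_eq_single 0 (fun b _ hb => by rw [hoff 0 b hb.symm, zero_mul]) (by simp),
      mul_comm, tMat_apply, tCoeff_zero_left] at H0
    exact mul_right_cancel₀ (mul_ne_zero (pow_ne_zero _ (hy 1 0)) (pow_ne_zero _ (hy 1 1))) H0
  have htr : ∑ r, avgMat L L q q' r r = if q = q' then 2 * (Real.pi : ℂ) ^ 2 else 0 := by
    simp only [avgMat, Matrix.of_apply]
    rw [← intSU2_sum _ _ fun r _ => continuous_tCoeff_mul L L r q q' r]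
    rw [intSU2_congr (h := fun _ => if q = q' then 1 else 0), intSU2_const]
    · split_ifs <;> simp
    · intro x
      have h1 : tMat L (toSU2 x)⁻¹ * tMat L (toSU2 x) = 1 := by
        rw [← tMat_mul, Matrix.nonsing_inv_mul _ (by rw [det_toSU2]; exact isUnit_one), tMat_one]
      have h2 := congrFun (congrFun h1 q') q
      rw [Matrix.mul_apply, Matrix.one_apply] at h2
      simp only [tMat_apply, eq_comm (a := q')] at h2
      rw [← h2]
      exact Finset.sum_congr rfl fun r _ => mul_comm _ _
  rw [Finset.sum_congr rfl fun r _ => hdiag r, Finset.sum_const, Finset.card_univ, Fintype.card_fin,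
    nsmul_eq_mul] at htr
  have hL : ((L + 1 : ℕ) : ℂ) ≠ 0 := by exact_mod_cast L.succ_ne_zero
  rw [hdiag p, eq_div_of_mul_eq hL ((mul_comm _ _).trans htr)]
  by_cases hq : q = q' <;> simp [hq]

lemma intSU2_basisFn (a b : Lab) :
    intSU2 (fun X => basisFn (true, a) X * basisFn (false, b) X) =
      if a = b then 2 * (Real.pi : ℂ) ^ 2 / (a.1 + 1) else 0 := by
  obtain ⟨L, n, m⟩ := a
  obtain ⟨L', n', m'⟩ := b
  have h : intSU2 (fun X => basisFn (true, ⟨L, n, m⟩) X * basisFn (false, ⟨L', n', m'⟩) X) =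
      avgMat L L' m m' n n' := by
    rw [avgMat, Matrix.of_apply]
    exact intSU2_congr fun x => by simp [basisFn, det_toSU2]
  rw [h]
  by_cases hL : L = L'
  · subst hL
    rw [avgMat_same]
    congr 1
    simp [Sigma.ext_iff, Prod.ext_iff]
  · rw [avgMat_of_ne hL, if_neg fun h => hL (congrArg Sigma.fst h)]
    rfl

lemma intSU2_basisFn' (a b : Lab) :
    intSU2 (fun X => basisFn (false, a) X * basisFn (true, b) X) =
      if a = b then 2 * (Real.pi : ℂ) ^ 2 / (a.1 + 1) else 0 := by
  simp only [mul_comm (basisFn (false, a) _)]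
  rw [intSU2_basisFn]
  by_cases h : a = b
  · subst h; rfl
  · rw [if_neg h, if_neg (Ne.symm h)]

/-- The operator deg + 1 acts by ±(2l+1), which cancels the dimension 2l+1 in Schur orthogonality
and leaves only the sign. -/
lemma pairing_eq (i j : Idx) :
    pairing i j = if i.1 ≠ j.1 ∧ i.2 = j.2 then (if i.1 then 1 else -1) else 0 := by
  obtain ⟨ε, a⟩ := i
  obtain ⟨ε', b⟩ := j
  have ha : ((a.1 : ℂ) + 1) ≠ 0 := by exact_mod_cast a.1.succ_ne_zero
  have hpi : (Real.pi : ℂ) ≠ 0 := by exact_mod_cast Real.pi_ne_zero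
  cases ε <;> cases ε' <;>
    simp only [pairing, degTilde_basisFn, basisDeg, mul_assoc, intSU2_const_mul, intSU2_basisFn, intSU2_basisFn'] <;>
    by_cases h : a = b <;> simp [h] <;> subst h <;> field_simp <;> ring

/-! ### The map `I` on `N(Z)⁻¹` and on `1` -/

lemma evalZh_smul_NInv (c : ℂ) (W : HC) : evalZh (c • NInv) W = c * W.det⁻¹ := by
  unfold evalZh
  split_ifs with h
  · simp [NInv]
  -- At singular W both sides vanish, because the inverse of 0 is 0.
  · rw [Matrix.isUnit_iff_isUnit_det, isUnit_iff_ne_zero, not_not] at h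
    simp [h]

lemma evalZh_one {W : HC} (h : W.det ≠ 0) : evalZh 1 W = 1 := by
  have : IsUnit W := (Matrix.isUnit_iff_isUnit_det W).2 (isUnit_iff_ne_zero.2 h)
  simp [evalZh, this]

/-- `f ∈ Ж` is the function `c N(Z)^{-k}`. -/
def IsDetPow (f : Zh) (c : ℂ) (k : ℕ) : Prop :=
  ∀ W : HC, W.det ≠ 0 → evalZh f W = c * W.det⁻¹ ^ k

lemma isDetPow_smul_NInv (c : ℂ) : IsDetPow (c • NInv) c 1 := fun W _ => by
  rw [evalZh_smul_NInv, pow_one]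

lemma isDetPow_one : IsDetPow 1 1 0 := fun W h => by simp [evalZh_one h]

lemma det_smul_toSU2 (w : ℂ) (x : S3) : (w • toSU2 x).det = w ^ 2 := by
  simp [det_toSU2]

lemma intSU2_basisFn_not (ε : Bool) (a b : Lab) :
    intSU2 (fun X => basisFn (!ε, a) X * basisFn (ε, b) X) =
      if a = b then 2 * (Real.pi : ℂ) ^ 2 / (a.1 + 1) else 0 := by
  cases ε
  · exact intSU2_basisFn a b
  · exact intSU2_basisFn' a b

/-- Dual basis functions have degrees adding up to -2, so the integrand on the central circle is a
multiple of e^{(2-2k)iθ}. Over [0, π] this integrates to π for k = 1 and to 0 for k = 0. -/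
lemma mixedCoeff_eq {f : Zh} {c : ℂ} {k : ℕ} (hf : IsDetPow f c k) (hk : k ≤ 1) {i j : Idx}
    (hij : i.1 ≠ j.1) :
    mixedCoeff f i j = if i.2 = j.2 ∧ k = 1 then c / (i.2.1 + 1) else 0 := by
  have hj : (!j.1) = i.1 := by revert hij; cases i.1 <;> cases j.1 <;> simp
  have hpi : (Real.pi : ℂ) ≠ 0 := by exact_mod_cast Real.pi_ne_zero
  have hL : ((i.2.1 : ℂ) + 1) ≠ 0 := by exact_mod_cast i.2.1.succ_ne_zero
  have key : ∀ θ : ℝ, ((((1 : ℝ) : ℂ) * Complex.exp (Complex.I * θ)) ^ 4 *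
      intSU2 fun X => evalZh f ((((1 : ℝ) : ℂ) * Complex.exp (Complex.I * θ)) • X) *
        basisFn (!i.1, i.2) ((((1 : ℝ) : ℂ) * Complex.exp (Complex.I * θ)) • X) *
        basisFn (!j.1, j.2) ((((1 : ℝ) : ℂ) * Complex.exp (Complex.I * θ)) • X)) =
      (if i.2 = j.2 then c * (2 * (Real.pi : ℂ) ^ 2 / (i.2.1 + 1)) else 0) *
        Complex.exp ((2 - 2 * k : ℂ) * Complex.I * θ) := by
    intro θ
    rw [Complex.ofReal_one, one_mul]
    set u := Complex.exp (Complex.I * θ) with hu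
    have hu0 : u ≠ 0 := Complex.exp_ne_zero _
    have e : intSU2 (fun X => evalZh f (u • X) * basisFn (!i.1, i.2) (u • X) *
        basisFn (!j.1, j.2) (u • X)) =
        c * (u ^ 2)⁻¹ ^ k * (u ^ basisDeg (!i.1, i.2) * u ^ basisDeg (i.1, j.2)) *
          intSU2 fun X => basisFn (!i.1, i.2) X * basisFn (i.1, j.2) X := by
      rw [← intSU2_const_mul]
      refine intSU2_congr fun x => ?_
      rw [hf _ (by rw [det_smul_toSU2]; exact pow_ne_zero _ hu0), det_smul_toSU2, basisFn_smul _ _ hu0,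
        basisFn_smul _ _ hu0, hj]
      ring
    rw [e, intSU2_basisFn_not]
    by_cases h : i.2 = j.2
    · rw [if_pos h, if_pos h, ← h, ← zpow_add₀ hu0]
      have hd : basisDeg (!i.1, i.2) + basisDeg (i.1, i.2) = -2 := by
        cases i.1 <;> simp [basisDeg] <;> ring
      have hexp : Complex.exp ((2 - 2 * k : ℂ) * Complex.I * θ) = u ^ (2 : ℕ) * (u ^ 2)⁻¹ ^ k := by
        rw [hu, ← Complex.exp_nat_mul, ← Complex.exp_neg, ← Complex.exp_nat_mul, ← Complex.exp_add]
        congr 1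
        push_cast
        ring
      rw [hd, hexp, zpow_neg]
      have : u ^ (2 : ℤ) = u ^ 2 := by norm_cast
      rw [this]
      field_simp
    · rw [if_neg h, if_neg h]
      ring
  rw [mixedCoeff, intU2]
  simp only [key]
  rw [intervalIntegral.integral_const_mul]
  interval_cases k
  · have h0 : ∫ θ in (0 : ℝ)..Real.pi, Complex.exp ((2 - 2 * ((0 : ℕ) : ℂ)) * Complex.I * θ) = 0 := by
      rw [integral_exp_mul_complex (by simp)]
      simp only [Nat.cast_zero, mul_zero, sub_zero, Complex.ofReal_zero, Complex.exp_zero]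
      rw [show (2 * Complex.I * Real.pi : ℂ) = 2 * Real.pi * Complex.I by ring, Complex.exp_two_pi_mul_I]
      simp
    rw [h0]
    simp
  · simp only [Nat.cast_one, mul_one, sub_self, zero_mul, Complex.exp_zero,
      intervalIntegral.integral_const, sub_zero, Complex.real_smul, and_true]
    split_ifs
    · field_simp
      rw [Complex.I_sq]
      ring
    · simp

lemma toSU2_mem_DR (ε : Bool) (x : S3) : toSU2 x ∈ DR ε (if ε then 2 else 1 / 2) := by
  cases ε
  · show (toSU2 x * (toSU2 x)ᴴ - _).PosDef
    rw [toSU2_mul_conjTranspose, ← one_smul ℂ (1 : HC), smul_smul, ← sub_smul]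
    refine Matrix.PosDef.one.smul ?_
    norm_num [Complex.lt_def]
  · show (_ - toSU2 x * (toSU2 x)ᴴ).PosDef
    rw [toSU2_mul_conjTranspose]
    nth_rw 2 [← one_smul ℂ (1 : HC)]
    rw [← sub_smul]
    refine Matrix.PosDef.one.smul ?_
    norm_num [Complex.lt_def]

/-! ### Uniqueness of the expansion defining the equal-sign parts -/

/-- The products of basis functions of a given sign are linearly independent. -/
lemma tensor_eq_zero (ε : Bool) (a : Lab × Lab →₀ ℂ)
    (h : ∀ x y : S3, (a.sum fun p c => c * basisFn (ε, p.1) (toSU2 x) * basisFn (ε, p.2) (toSU2 y)) = 0) :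
    a = 0 := by
  have hn : ∀ b : Lab, (2 * (Real.pi : ℂ) ^ 2 / (b.1 + 1)) ≠ 0 := fun b => by
    refine div_ne_zero (mul_ne_zero two_ne_zero (pow_ne_zero _ ?_)) ?_
    · exact_mod_cast Real.pi_ne_zero
    · exact_mod_cast b.1.succ_ne_zero
  ext ⟨p, q⟩
  -- Integrating against the dual basis function in the second variable isolates the terms with
  -- second label `q`; `h2` does the same for `p` in the first.
  have h1 : ∀ x : S3, ∑ r ∈ a.support, a r * basisFn (ε, r.1) (toSU2 x) *
      (if q = r.2 then 2 * (Real.pi : ℂ) ^ 2 / (q.1 + 1) else 0) = 0 := by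
    intro x
    have e : intSU2 (fun Y => ∑ r ∈ a.support, a r * basisFn (ε, r.1) (toSU2 x) *
        (basisFn (!ε, q) Y * basisFn (ε, r.2) Y)) = intSU2 fun _ => 0 := by
      refine intSU2_congr fun y => ?_
      have := congrArg (fun t => basisFn (!ε, q) (toSU2 y) * t) (h x y)
      simp only [Finsupp.sum, Finset.mul_sum, mul_zero] at this
      refine Eq.trans ?_ this
      exact Finset.sum_congr rfl fun r _ => by ring
    rw [intSU2_const, mul_zero, intSU2_sum _ _ fun r _ => continuous_const.mul
      ((continuous_basisFn_toSU2 _).mul (continuous_basisFn_toSU2 _))] at e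
    refine Eq.trans ?_ e
    exact Finset.sum_congr rfl fun r _ => by rw [intSU2_const_mul, intSU2_basisFn_not]
  have h2 : ∑ r ∈ a.support, a r * (if q = r.2 then 2 * (Real.pi : ℂ) ^ 2 / (q.1 + 1) else 0) *
      (if p = r.1 then 2 * (Real.pi : ℂ) ^ 2 / (p.1 + 1) else 0) = 0 := by
    have e : intSU2 (fun X => ∑ r ∈ a.support,
        a r * (if q = r.2 then 2 * (Real.pi : ℂ) ^ 2 / (q.1 + 1) else 0) *
        (basisFn (!ε, p) X * basisFn (ε, r.1) X)) = intSU2 fun _ => 0 := by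
      refine intSU2_congr fun x => ?_
      have := congrArg (fun t => basisFn (!ε, p) (toSU2 x) * t) (h1 x)
      simp only [Finset.mul_sum, mul_zero] at this
      refine Eq.trans ?_ this
      exact Finset.sum_congr rfl fun r _ => by ring
    rw [intSU2_const, mul_zero, intSU2_sum _ _ fun r _ => continuous_const.mul
      ((continuous_basisFn_toSU2 _).mul (continuous_basisFn_toSU2 _))] at e
    refine Eq.trans ?_ e
    exact Finset.sum_congr rfl fun r _ => by rw [intSU2_const_mul, intSU2_basisFn_not]
  by_contra hne
  rw [Finset.sum_eq_single (p, q)] at h2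
  · simp only [if_true] at h2
    exact mul_ne_zero (mul_ne_zero hne (hn q)) (hn p) h2
  · rintro ⟨r, s⟩ _ hrs
    by_cases hq : q = s
    · rw [if_neg (fun hp : p = r => hrs (by rw [hp, hq])), mul_zero]
    · rw [if_neg hq, mul_zero, zero_mul]
  · intro hs
    exact absurd (Finsupp.mem_support_iff.2 hne) hs

/-- `samePart` is an arbitrary choice among valid coefficient arrays. Comparing two of them on
`SU(2)` × `SU(2)`, which lies in the domain for R = 2 or R = 1/2, shows that there is only one. -/
lemma samePart_eq {ε : Bool} {f : Zh} {a : Lab × Lab →₀ ℂ} (ha : IsSamePart ε f a) :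
    samePart ε f = a := by
  have hex : ∃ a, IsSamePart ε f a := ⟨a, ha⟩
  rw [samePart, dif_pos hex, ← sub_eq_zero]
  refine tensor_eq_zero ε _ fun x y => ?_
  have hR : (0 : ℝ) < if ε then 2 else 1 / 2 := by split_ifs <;> norm_num
  rw [Finsupp.sum_sub_index (by intros; ring),
    ← hex.choose_spec _ hR _ (toSU2_mem_DR ε x) _ (toSU2_mem_DR ε y),
    ← ha _ hR _ (toSU2_mem_DR ε x) _ (toSU2_mem_DR ε y), sub_self]

/-! ### The equal-sign integrals for N⁻¹ and 1, by the mean value property -/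

/-- The integrand of `I_R` in the coordinates `W = w X`. -/
def kerIR (c : ℂ) (k : ℕ) (Z₁ Z₂ : HC) (w : ℂ) (X : HC) : ℂ :=
  w ^ 4 * (c * (w ^ 2)⁻¹ ^ k / ((w • X - Z₁).det * (w • X - Z₂).det))

lemma det_neg_HC (A : HC) : (-A).det = A.det := by
  rw [Matrix.det_neg]; simp

lemma kerIR_neg (c : ℂ) (k : ℕ) (Z₁ Z₂ : HC) (w : ℂ) (X : HC) :
    kerIR c k Z₁ Z₂ w (-X) = kerIR c k Z₁ Z₂ (-w) X := by
  simp [kerIR]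
  left
  ring

lemma posDef_smul_toSU2 (R : ℝ) (x : S3) :
    ((R : ℂ) • toSU2 x) * ((R : ℂ) • toSU2 x)ᴴ = ((R : ℂ) ^ 2) • (1 : HC) := by
  rw [Matrix.conjTranspose_smul, Matrix.smul_mul, Matrix.mul_smul, toSU2_mul_conjTranspose, smul_smul]
  simp [sq]

lemma det_sub_ne_zero_of_mem_DR_true {R : ℝ} {Z : HC} (hZ : Z ∈ DR true R) (x : S3) {u : ℂ}
    (hu : ‖u‖ ≤ 1) : ((R : ℂ) • toSU2 x - u • Z).det ≠ 0 :=
  det_sub_smul_ne_zero (by rw [posDef_smul_toSU2]; exact hZ) hu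

lemma det_sub_ne_zero_of_mem_DR_false {R : ℝ} {Z : HC} (hZ : Z ∈ DR false R) (x : S3) {u : ℂ}
    (hu : ‖u‖ ≤ 1) : (u • (R : ℂ) • toSU2 x - Z).det ≠ 0 := by
  rw [← det_neg_HC, neg_sub]
  exact det_sub_smul_ne_zero (by rw [posDef_smul_toSU2]; exact hZ) hu

lemma integral_circle_eq {h : ℂ → ℂ} (hd : DifferentiableOn ℂ h (Metric.closedBall 0 1)) :
    ∫ θ in (0 : ℝ)..2 * Real.pi, h (Complex.exp (Complex.I * θ)) = 2 * Real.pi * h 0 := by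
  have hdc : DiffContOnCl ℂ h (Metric.ball 0 |1|) := by
    rw [abs_one]
    exact DifferentiableOn.diffContOnCl (by rwa [closure_ball _ one_ne_zero])
  have := hdc.circleAverage
  rw [Real.circleAverage] at this
  simp only [circleMap, Complex.ofReal_one, one_mul, zero_add] at this
  rw [← this, Complex.real_smul]
  have hpi : (Real.pi : ℂ) ≠ 0 := by exact_mod_cast Real.pi_ne_zero
  push_cast
  rw [mul_inv_cancel_left₀ (mul_ne_zero two_ne_zero hpi)]
  simp only [mul_comm Complex.I]

lemma integral_circle_inv_eq {h : ℂ → ℂ} (hd : DifferentiableOn ℂ h (Metric.closedBall 0 1)) :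
    ∫ θ in (0 : ℝ)..2 * Real.pi, h (Complex.exp (Complex.I * θ))⁻¹ = 2 * Real.pi * h 0 := by
  rw [← integral_circle_eq hd]
  have := intervalIntegral.integral_comp_sub_left (a := 0) (b := 2 * Real.pi)
    (fun θ : ℝ => h (Complex.exp (Complex.I * θ))) (2 * Real.pi)
  rw [sub_self, sub_zero] at this
  rw [← this]
  congr 1
  ext θ
  rw [← Complex.exp_neg]
  congr 1
  rw [Complex.exp_eq_exp_iff_exists_int]
  exact ⟨-1, by push_cast; ring⟩

/-- In the - case the integrand is holomorphic in v = e^{iθ} on the closed disc and vanishes at 0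
like v^{4-2k}. In the + case it is holomorphic in u = e^{-iθ}, and its value at u = 0 is c for k = 0
and 0 for k = 1. -/
lemma integral_kerIR {ε : Bool} {R : ℝ} (hR : 0 < R) {Z₁ Z₂ : HC} (h₁ : Z₁ ∈ DR ε R) (h₂ : Z₂ ∈ DR ε R)
    (c : ℂ) {k : ℕ} (hk : k ≤ 1) (x : S3) :
    ∫ θ in (0 : ℝ)..2 * Real.pi, kerIR c k Z₁ Z₂ (R * Complex.exp (Complex.I * θ)) (toSU2 x) =
      2 * Real.pi * (if ε = true ∧ k = 0 then c else 0) := by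
  have hR0 : (R : ℂ) ≠ 0 := by exact_mod_cast hR.ne'
  cases ε
  · let h : ℂ → ℂ := fun v => c * R ^ (4 - 2 * k) * v ^ (4 - 2 * k) /
      ((v • (R : ℂ) • toSU2 x - Z₁).det * (v • (R : ℂ) • toSU2 x - Z₂).det)
    have hd : DifferentiableOn ℂ h (Metric.closedBall 0 1) := by
      intro v hv
      have hv' : ‖v‖ ≤ 1 := by simpa using hv
      refine DifferentiableAt.differentiableWithinAt (DifferentiableAt.div (by fun_prop) ?_
        (mul_ne_zero (det_sub_ne_zero_of_mem_DR_false h₁ x hv') (det_sub_ne_zero_of_mem_DR_false h₂ x hv')))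
      simp only [Matrix.det_fin_two, Matrix.sub_apply, Matrix.smul_apply, smul_eq_mul]
      fun_prop
    have e := integral_circle_eq hd
    have h0 : h 0 = 0 := by
      simp only [h]
      rw [zero_pow (by omega)]
      simp
    rw [h0] at e
    rw [if_neg (by simp), ← e]
    refine intervalIntegral.integral_congr fun θ _ => ?_
    have hE : Complex.exp (Complex.I * θ) ≠ 0 := Complex.exp_ne_zero _
    simp only [kerIR, h, smul_smul, mul_comm (R : ℂ)]
    rw [← mul_div_assoc]
    congr 1
    interval_cases k <;> field_simp <;> norm_num <;> ring
  · let h : ℂ → ℂ := fun u => c * R ^ (4 - 2 * k) * u ^ (2 * k) /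
      (((R : ℂ) • toSU2 x - u • Z₁).det * ((R : ℂ) • toSU2 x - u • Z₂).det)
    have hd : DifferentiableOn ℂ h (Metric.closedBall 0 1) := by
      intro v hv
      have hv' : ‖v‖ ≤ 1 := by simpa using hv
      refine DifferentiableAt.differentiableWithinAt (DifferentiableAt.div (by fun_prop) ?_
        (mul_ne_zero (det_sub_ne_zero_of_mem_DR_true h₁ x hv') (det_sub_ne_zero_of_mem_DR_true h₂ x hv')))
      simp only [Matrix.det_fin_two, Matrix.sub_apply, Matrix.smul_apply, smul_eq_mul]
      fun_prop
    have e := integral_circle_inv_eq hd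
    have h0 : h 0 = if true = true ∧ k = 0 then c else 0 := by
      simp only [h, zero_smul, sub_zero, det_smul_toSU2]
      interval_cases k
      · simp; field_simp
      · simp
    rw [h0] at e
    rw [← e]
    refine intervalIntegral.integral_congr fun θ _ => ?_
    have hE : Complex.exp (Complex.I * θ) ≠ 0 := Complex.exp_ne_zero _
    simp only [kerIR, h]
    set E := Complex.exp (Complex.I * θ)
    have hdet : ∀ Z : HC, ((R : ℂ) • toSU2 x - E⁻¹ • Z).det = E⁻¹ ^ 2 * (((R : ℂ) * E) • toSU2 x - Z).det := by
      intro Z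
      have : (R : ℂ) • toSU2 x - E⁻¹ • Z = E⁻¹ • (((R : ℂ) * E) • toSU2 x - Z) := by
        rw [smul_sub, smul_smul]
        congr 2
        field_simp
      rw [this, Matrix.det_smul]
      simp
    rw [hdet, hdet, ← mul_div_assoc]
    have hn : ∀ Z ∈ DR true R, (((R : ℂ) * E) • toSU2 x - Z).det ≠ 0 := by
      intro Z hZ h0
      refine det_sub_ne_zero_of_mem_DR_true hZ x (u := E⁻¹) ?_ (by rw [hdet, h0, mul_zero])
      rw [norm_inv]
      simp [E, Complex.norm_exp]
    have n1 := hn _ h₁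
    have n2 := hn _ h₂
    interval_cases k <;> field_simp <;> norm_num <;> field_simp

lemma continuous_kerIR {ε : Bool} {R : ℝ} (hR : 0 < R) {Z₁ Z₂ : HC} (h₁ : Z₁ ∈ DR ε R) (h₂ : Z₂ ∈ DR ε R)
    (c : ℂ) (k : ℕ) :
    Continuous fun p : ℝ × S3 => kerIR c k Z₁ Z₂ (R * Complex.exp (Complex.I * p.1)) (toSU2 p.2) := by
  have hR0 : (R : ℂ) ≠ 0 := by exact_mod_cast hR.ne'
  have hX : Continuous fun p : ℝ × S3 => toSU2 p.2 := continuous_toSU2.comp continuous_snd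
  have hw : Continuous fun p : ℝ × S3 => (R * Complex.exp (Complex.I * p.1) : ℂ) := by fun_prop
  have hw0 : ∀ p : ℝ × S3, (R * Complex.exp (Complex.I * p.1) : ℂ) ≠ 0 := fun p =>
    mul_ne_zero hR0 (Complex.exp_ne_zero _)
  have hn : ∀ Z ∈ DR ε R, ∀ p : ℝ × S3,
      ((R * Complex.exp (Complex.I * p.1) : ℂ) • toSU2 p.2 - Z).det ≠ 0 := by
    intro Z hZ p
    set E := Complex.exp (Complex.I * p.1) with hE
    have hE1 : ‖E‖ = 1 := by simp [E, Complex.norm_exp]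
    have hE0 : E ≠ 0 := Complex.exp_ne_zero _
    rw [mul_comm]
    cases ε
    · rw [← smul_smul]
      exact det_sub_ne_zero_of_mem_DR_false hZ p.2 hE1.le
    · have e : (E * (R : ℂ)) • toSU2 p.2 - Z = E • ((R : ℂ) • toSU2 p.2 - E⁻¹ • Z) := by
        rw [smul_sub, smul_smul, smul_smul, mul_inv_cancel₀ hE0, one_smul]
      rw [e, Matrix.det_smul]
      exact mul_ne_zero (pow_ne_zero _ hE0)
        (det_sub_ne_zero_of_mem_DR_true hZ p.2 (by rw [norm_inv, hE1, inv_one]))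
  have hdet : ∀ Z : HC, Continuous fun p : ℝ × S3 =>
      ((R * Complex.exp (Complex.I * p.1) : ℂ) • toSU2 p.2 - Z).det := fun Z =>
    ((hw.smul hX).sub continuous_const).matrix_det
  refine (hw.pow 4).mul (Continuous.div ?_ ((hdet Z₁).mul (hdet Z₂))
    fun p => mul_ne_zero (hn _ h₁ p) (hn _ h₂ p))
  exact continuous_const.mul (((hw.pow 2).inv₀ fun p => pow_ne_zero _ (hw0 p)).pow k)

/-- Averaging over `U(2)_R` by first averaging over the central circle. -/
lemma integral_intSU2_of_circle (F : ℂ → HC → ℂ) (R : ℝ) (C : ℂ)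
    (hF : Continuous fun p : ℝ × S3 => F (R * Complex.exp (Complex.I * p.1)) (toSU2 p.2))
    (hneg : ∀ w X, F w (-X) = F (-w) X)
    (hC : ∀ x : S3, ∫ θ in (0 : ℝ)..2 * Real.pi, F (R * Complex.exp (Complex.I * θ)) (toSU2 x) = C) :
    ∫ θ in (0 : ℝ)..Real.pi, intSU2 (F (R * Complex.exp (Complex.I * θ))) = (Real.pi : ℂ) ^ 2 * C := by
  obtain ⟨K, hKdef⟩ : ∃ K : ℝ → S3 → ℂ, K = fun (θ : ℝ) x => F (R * Complex.exp (Complex.I * θ)) (toSU2 x) :=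
    ⟨_, rfl⟩
  have hK : Continuous (Function.uncurry K) := by rw [hKdef]; exact hF
  have hx : ∀ x, Continuous fun θ => K θ x := fun x => hK.comp (continuous_id.prodMk continuous_const)
  have hint : Integrable (Function.uncurry K) ((volume.restrict (Set.uIoc 0 Real.pi)).prod
      (volume : Measure (EuclideanSpace ℝ (Fin 4))).toSphere) := by
    have : IntegrableOn (Function.uncurry K) (Set.uIcc 0 Real.pi ×ˢ Set.univ)
        (volume.prod (volume : Measure (EuclideanSpace ℝ (Fin 4))).toSphere) :=
      hK.continuousOn.integrableOn_compact (isCompact_uIcc.prod isCompact_univ)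
    have h2 := this.mono_set (Set.prod_mono Set.uIoc_subset_uIcc (le_refl Set.univ))
    rwa [IntegrableOn, ← Measure.prod_restrict, Measure.restrict_univ] at h2
  -- Since (-w)X = w(-X), the substitution X ↦ -X exchanges the two half circles. The integral over
  -- [0, π] is thus half of the one over the full circle, where `hC` applies.
  have e2 : intSU2 (fun X => ∫ θ in (0 : ℝ)..Real.pi, F (R * Complex.exp (Complex.I * θ)) X) =
      intSU2 (fun X => ∫ θ in Real.pi..2 * Real.pi, F (R * Complex.exp (Complex.I * θ)) X) := by
    rw [← intSU2_neg]
    congr 1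
    ext X
    have h := intervalIntegral.integral_comp_add_right (a := 0) (b := Real.pi)
      (fun θ : ℝ => F (R * Complex.exp (Complex.I * θ)) X) Real.pi
    rw [zero_add, ← two_mul] at h
    rw [← h]
    refine intervalIntegral.integral_congr fun θ _ => ?_
    simp only [hneg]
    congr 1
    push_cast
    rw [mul_add, Complex.exp_add, mul_comm Complex.I (Real.pi : ℂ), Complex.exp_pi_mul_I]
    ring
  have hc : ∀ a b : ℝ, Continuous fun x : S3 => ∫ θ in a..b, F (R * Complex.exp (Complex.I * θ)) (toSU2 x) := by
    intro a b
    have := intervalIntegral.continuous_parametric_intervalIntegral_of_continuous' (μ := volume)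
      (f := fun x θ => K θ x) (hK.comp continuous_swap) a b
    rw [hKdef] at this
    exact this
  have e3 : intSU2 (fun X => ∫ θ in (0 : ℝ)..Real.pi, F (R * Complex.exp (Complex.I * θ)) X) +
      intSU2 (fun X => ∫ θ in Real.pi..2 * Real.pi, F (R * Complex.exp (Complex.I * θ)) X) =
        2 * (Real.pi : ℂ) ^ 2 * C := by
    rw [← intSU2_const]
    refine (integral_add (integrable_S3 (hc _ _)) (integrable_S3 (hc _ _))).symm.trans ?_
    refine integral_congr_ae (Eventually.of_forall fun x => ?_)
    have hx' := hx x
    rw [hKdef] at hx'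
    exact (intervalIntegral.integral_add_adjacent_intervals (hx'.intervalIntegrable _ _)
      (hx'.intervalIntegrable _ _)).trans (hC x)
  have e4 := intervalIntegral_integral_swap hint
  rw [hKdef] at e4
  refine e4.trans ?_
  change intSU2 (fun X => ∫ θ in (0 : ℝ)..Real.pi, F (R * Complex.exp (Complex.I * θ)) X) = _
  rw [← e2] at e3
  linear_combination e3 / 2

lemma IR_eq {f : Zh} {c : ℂ} {k : ℕ} (hf : IsDetPow f c k) (hk : k ≤ 1) {ε : Bool} {R : ℝ}
    (hR : 0 < R) {Z₁ Z₂ : HC} (h₁ : Z₁ ∈ DR ε R) (h₂ : Z₂ ∈ DR ε R) :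
    IR R f Z₁ Z₂ = if ε = true ∧ k = 0 then c else 0 := by
  have hR0 : (R : ℂ) ≠ 0 := by exact_mod_cast hR.ne'
  have hpi : (Real.pi : ℂ) ≠ 0 := by exact_mod_cast Real.pi_ne_zero
  have e := integral_intSU2_of_circle (kerIR c k Z₁ Z₂) R _ (continuous_kerIR hR h₁ h₂ c k)
    (kerIR_neg c k Z₁ Z₂) (integral_kerIR hR h₁ h₂ c hk)
  have e1 : ∀ θ : ℝ, ((R : ℂ) * Complex.exp (Complex.I * (θ : ℂ))) ^ 4 *
      intSU2 (fun X => evalZh f (((R : ℂ) * Complex.exp (Complex.I * (θ : ℂ))) • X) /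
        (((((R : ℂ) * Complex.exp (Complex.I * (θ : ℂ))) • X) - Z₁).det *
          ((((R : ℂ) * Complex.exp (Complex.I * (θ : ℂ))) • X) - Z₂).det)) =
      intSU2 (kerIR c k Z₁ Z₂ (R * Complex.exp (Complex.I * θ))) := by
    intro θ
    rw [← intSU2_const_mul]
    refine intSU2_congr fun x => ?_
    have hw : (R : ℂ) * Complex.exp (Complex.I * θ) ≠ 0 := mul_ne_zero hR0 (Complex.exp_ne_zero _)
    rw [hf _ (by rw [det_smul_toSU2]; exact pow_ne_zero _ hw), det_smul_toSU2]
    rfl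
  rw [IR, intU2]
  simp only [e1]
  rw [e]
  field_simp
  rw [Complex.I_sq]
  ring

/-! ### Coefficient arrays of I(N⁻¹) and I(1) and their convolutions -/

/-- The label of the constant function `1`. -/
def lab0 : Lab := ⟨0, 0, 0⟩

lemma basisFn_lab0 (Z : HC) : basisFn (true, lab0) Z = 1 := by
  simp [basisFn, lab0, tCoeff]

lemma samePart_of_isDetPow {f : Zh} {c : ℂ} {k : ℕ} (hf : IsDetPow f c k) (hk : k ≤ 1) (ε : Bool) :
    samePart ε f = if ε = true ∧ k = 0 then Finsupp.single (lab0, lab0) c else 0 := by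
  refine samePart_eq fun R hR Z₁ h₁ Z₂ h₂ => ?_
  rw [IR_eq hf hk hR h₁ h₂]
  split_ifs with h
  · rw [Finsupp.sum_single_index (by simp), h.1]
    simp [basisFn_lab0]
  · simp

/-- The array supported on pairs of dual labels, with entries depending only on `2l`. -/
def dualArr (x y : ℕ → ℂ) : Arr := fun i j =>
  if i.1 ≠ j.1 ∧ i.2 = j.2 then (if i.1 then x i.2.1 else y i.2.1) else 0

/-- The array with the single entry `c` at the constant function `1 ⊗ 1`. -/
def constArr (c : ℂ) : Arr := fun i j => if i = (true, lab0) ∧ j = (true, lab0) then c else 0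

lemma mapI_smul_NInv (c : ℂ) :
    mapI (c • NInv) = dualArr (fun L => -(c / (L + 1))) (fun L => -(c / (L + 1))) := by
  ext i j
  simp only [mapI, dualArr]
  by_cases h : i.1 = j.1
  · rw [if_pos h, samePart_of_isDetPow (isDetPow_smul_NInv c) le_rfl]
    simp [h]
  · rw [if_neg h, mixedCoeff_eq (isDetPow_smul_NInv c) le_rfl h]
    by_cases h' : i.2 = j.2 <;> simp [h, h']

lemma mapI_NInv : mapI NInv = dualArr (fun L => -(1 / (L + 1))) (fun L => -(1 / (L + 1))) := by
  rw [← mapI_smul_NInv, one_smul]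

lemma mapI_one : mapI 1 = constArr 1 := by
  ext ⟨ε, a⟩ ⟨ε', b⟩
  simp only [mapI, constArr]
  by_cases h : ε = ε'
  · subst h
    rw [if_pos rfl, samePart_of_isDetPow isDetPow_one zero_le_one]
    cases ε
    · simp
    · simp [Finsupp.single_apply, Prod.ext_iff, eq_comm]
  · rw [if_neg h, mixedCoeff_eq isDetPow_one zero_le_one h]
    have : ¬(ε = true ∧ ε' = true) := fun h' => h (h'.1.trans h'.2.symm)
    simp only [Prod.mk.injEq]
    rw [if_neg (by simp), if_neg (by tauto), neg_zero]

/-- From the row `i` the array leads only to the dual index, and the pairing leads only back to `i`,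
so convolution rescales rows. The sign is the value of the pairing at (dual of `i`, `i`). -/
lemma conv_dualArr (x y : ℕ → ℂ) (G : Arr) (i k : Idx) :
    conv (dualArr x y) G i k = (if i.1 then -x i.2.1 else y i.2.1) * G i k := by
  rw [conv, finsum_eq_single _ ((!i.1, i.2), i)]
  · simp only [dualArr, pairing_eq]
    cases i.1 <;> simp
  · rintro ⟨p, q⟩ hpq
    simp only [dualArr, pairing_eq]
    by_cases h1 : i.1 ≠ p.1 ∧ i.2 = p.2
    · by_cases h2 : p.1 ≠ q.1 ∧ p.2 = q.2
      · refine absurd ?_ hpq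
        have a1 : p.1 = !i.1 := by
          have := h1.1
          revert this; cases i.1 <;> cases p.1 <;> simp
        have a2 : q.1 = i.1 := by
          have := h2.1
          rw [a1] at this
          revert this; cases i.1 <;> cases q.1 <;> simp
        exact Prod.ext (Prod.ext a1 h1.2.symm) (Prod.ext a2 (h2.2.symm.trans h1.2.symm))
      · rw [if_neg h2]; ring
    · rw [if_neg h1]; ring

lemma conv_dualArr_dualArr (x y x' y' : ℕ → ℂ) :
    conv (dualArr x y) (dualArr x' y') = dualArr (fun L => -(x L * x' L)) (fun L => y L * y' L) := by
  ext i k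
  rw [conv_dualArr]
  simp only [dualArr]
  by_cases h : i.1 ≠ k.1 ∧ i.2 = k.2
  · rw [if_pos h, if_pos h]
    cases i.1 <;> simp
  · rw [if_neg h, if_neg h, mul_zero]

/-- The only row of I(1) is the one with 2l = 0 and sign +, where I(cN⁻¹) acts by c. -/
lemma conv_smul_NInv_one (c : ℂ) : conv (mapI (c • NInv)) (mapI 1) = constArr c := by
  ext i k
  rw [mapI_smul_NInv, mapI_one, conv_dualArr]
  simp only [constArr]
  by_cases h : i = (true, lab0) ∧ k = (true, lab0)
  · rw [if_pos h, if_pos h, h.1]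
    simp [lab0]
  · rw [if_neg h, if_neg h, mul_zero]

lemma nConv_NInv (n : ℕ) : nConv (mapI NInv) (n + 1) =
    dualArr (fun L => -(1 / (L + 1)) ^ (n + 1)) (fun L => (-(1 / (L + 1))) ^ (n + 1)) := by
  induction n with
  | zero => simp [nConv, mapI_NInv]
  | succ n ih =>
    rw [nConv, ih, mapI_NInv, conv_dualArr_dualArr]
    congr 1
    ext L
    ring

/-! ### Membership in `𝓗𝓗^ω` -/

lemma dualArr_mem_HH (x y : ℕ → ℂ) : dualArr x y ∈ HH := by
  refine ⟨?_, 0, ?_⟩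
  · convert! Set.finite_empty
    ext p
    simp only [dualArr, Set.mem_ofPred_eq, Set.mem_empty_iff_false, iff_false, not_and, not_not]
    intro h
    rw [if_neg fun h' => h'.1 h]
  · intro i j _ h
    have : i.2 = j.2 := by
      by_contra h'
      exact h (if_neg fun h2 => h' h2.2)
    rw [this]
    simp

lemma nConv_NInv_mem_HHω (n : ℕ) : nConv (mapI NInv) (n + 1) ∈ HHω := by
  refine ⟨by rw [nConv_NInv]; exact dualArr_mem_HH _ _, ?_⟩
  rw [SetLike.mem_coe, Submodule.mem_sInf]
  intro S hS
  induction n with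
  | zero => exact hS.mapI_mem NInv
  | succ n ih =>
    -- Convolution with I(N⁻¹) multiplies by 1/(L+1) on sign + and by -1/(L+1) on sign -. This is
    -- (deg+1)⁻¹ in Z₁, which discards nothing for d = 1.
    have : nConv (mapI NInv) (n + 1 + 1) = degInv₁ 1 (nConv (mapI NInv) (n + 1)) := by
      rw [nConv_NInv, nConv_NInv]
      ext ⟨ε, L, a⟩ j
      simp only [degInv₁, dualArr]
      split_ifs with h1 h2
      · have h2' : ε = true := h2
        subst h2'
        rw [degInvCoeff]
        rw [if_pos (by omega)]
        push_cast
        ring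
      · have h2' : ε = false := by simpa using h2
        subst h2'
        rw [degInvCoeff]
        rw [if_pos (by omega)]
        push_cast
        rw [show (L : ℂ) + 2 - 1 = L + 1 by ring]
        ring
      · simp
    rw [this]
    exact hS.degInv₁_mem 1 _ ih

lemma constArr_mem_HHω (c : ℂ) : constArr c ∈ HHω := by
  have hfin : {p : Idx × Idx | constArr c p.1 p.2 ≠ 0}.Finite := by
    refine (Set.finite_singleton (((true, lab0), (true, lab0)) : Idx × Idx)).subset fun p hp => ?_
    by_contra h
    exact hp (if_neg fun h' => h (Prod.ext h'.1 h'.2))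
  refine ⟨⟨hfin.subset fun p hp => hp.2, 0, fun i j hij h => absurd ?_ h⟩, ?_⟩
  · exact if_neg fun h' => hij (by rw [h'.1, h'.2])
  · rw [SetLike.mem_coe, Submodule.mem_sInf]
    exact fun S hS => hS.finite_mem _ hfin

/-! ### Contour shifts and the logistic weight -/

/-- Common majorant for all contour shifts; it follows from t^m ≤ m! e^t with t = |x| + c and m = k,
k + 2. -/
lemma exists_decay_bound (k : ℕ) (c : ℝ) (hc : 0 ≤ c) :
    ∃ C : ℝ, 0 ≤ C ∧ ∀ x : ℝ, (|x| + c) ^ k * Real.exp (-|x|) ≤ C * (1 + x ^ 2)⁻¹ := by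
  refine ⟨Real.exp c * (k.factorial + (k + 2).factorial), by positivity, fun x => ?_⟩
  set t := |x| + c with ht
  have ht0 : 0 ≤ t := by positivity
  have hx : x ^ 2 ≤ t ^ 2 := by
    rw [← sq_abs x]
    exact pow_le_pow_left₀ (abs_nonneg x) (by linarith) 2
  have hm : ∀ m : ℕ, t ^ m ≤ m.factorial * Real.exp t := fun m => by
    have := Real.pow_div_factorial_le_exp t ht0 m
    rw [div_le_iff₀ (by positivity)] at this
    linarith
  rw [← div_eq_mul_inv, le_div_iff₀ (by positivity)]
  have he : Real.exp (-|x|) = Real.exp c * Real.exp (-t) := by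
    rw [← Real.exp_add]; congr 1; rw [ht]; ring
  calc t ^ k * Real.exp (-|x|) * (1 + x ^ 2)
      ≤ t ^ k * Real.exp (-|x|) * (1 + t ^ 2) := by gcongr
    _ = Real.exp c * ((t ^ k + t ^ (k + 2)) * Real.exp (-t)) := by rw [he]; ring
    _ ≤ Real.exp c * ((k.factorial * Real.exp t + (k + 2).factorial * Real.exp t) * Real.exp (-t)) := by
        gcongr
        · exact hm k
        · exact hm (k + 2)
    _ = Real.exp c * (k.factorial + (k + 2).factorial) := by
        rw [← add_mul, mul_assoc, ← Real.exp_add, add_neg_cancel, Real.exp_zero, mul_one]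

/-- Shifting the line of integration inside a horizontal strip. -/
lemma integral_horizontal_eq {F : ℂ → ℂ} {a b C : ℝ} (hab : a ≤ b)
    (hd : ∀ z : ℂ, a ≤ z.im → z.im ≤ b → DifferentiableAt ℂ F z)
    (ha : Integrable fun x : ℝ => F (x + a * Complex.I))
    (hb : Integrable fun x : ℝ => F (x + b * Complex.I))
    (hC : ∀ x y : ℝ, 1 ≤ |x| → a ≤ y → y ≤ b → ‖F (x + y * Complex.I)‖ ≤ C * (1 + x ^ 2)⁻¹) :
    ∫ x : ℝ, F (x + a * Complex.I) = ∫ x : ℝ, F (x + b * Complex.I) := by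
  -- Cauchy's theorem on the rectangle [-T, T] × [a, b]; the vertical sides vanish as T → ∞. The
  -- bound is needed only for |x| ≥ 1, so it may fail near a removable singularity.
  have hrect : ∀ T : ℝ, (∫ x in -T..T, F (x + a * Complex.I)) - (∫ x in -T..T, F (x + b * Complex.I)) =
      Complex.I * (∫ y in a..b, F ((-T : ℝ) + y * Complex.I)) -
        Complex.I * ∫ y in a..b, F (T + y * Complex.I) := by
    intro T
    have := Complex.integral_boundary_rect_eq_zero_of_differentiableOn F ⟨-T, a⟩ ⟨T, b⟩ (by
      intro z hz
      have hz2 := hz.2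
      simp only [Set.mem_preimage, Set.uIcc_of_le hab, Set.mem_Icc] at hz2
      exact (hd z hz2.1 hz2.2).differentiableWithinAt)
    simp only [smul_eq_mul] at this
    linear_combination this
  have hv : ∀ s : ℝ, |s| = 1 → Tendsto (fun T : ℝ => ∫ y in a..b, F ((s * T : ℝ) + y * Complex.I)) atTop (𝓝 0) := by
    intro s hs
    have hlim : Tendsto (fun T : ℝ => C * (1 + T ^ 2)⁻¹ * |b - a|) atTop (𝓝 0) := by
      have h1 : Tendsto (fun T : ℝ => 1 + T ^ 2) atTop atTop :=
        tendsto_atTop_add_const_left _ _ (tendsto_pow_atTop two_ne_zero)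
      simpa using (h1.inv_tendsto_atTop.const_mul C).mul_const |b - a|
    refine squeeze_zero_norm' ?_ hlim
    filter_upwards [eventually_ge_atTop 1] with T hT
    refine intervalIntegral.norm_integral_le_of_norm_le_const fun y hy => ?_
    rw [Set.uIoc_of_le hab] at hy
    have h2 : |s * T| = T := by rw [abs_mul, hs, one_mul, abs_of_nonneg (by linarith)]
    have := hC (s * T) y (by rw [h2]; exact hT) hy.1.le hy.2
    rwa [← sq_abs, h2] at this
  have hlim1 : Tendsto (fun T : ℝ => (∫ x in -T..T, F (x + a * Complex.I)) -
      (∫ x in -T..T, F (x + b * Complex.I))) atTop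
      (𝓝 ((∫ x : ℝ, F (x + a * Complex.I)) - ∫ x : ℝ, F (x + b * Complex.I))) :=
    (intervalIntegral_tendsto_integral ha tendsto_neg_atTop_atBot tendsto_id).sub
      (intervalIntegral_tendsto_integral hb tendsto_neg_atTop_atBot tendsto_id)
  have hlim2 : Tendsto (fun T : ℝ => (∫ x in -T..T, F (x + a * Complex.I)) -
      (∫ x in -T..T, F (x + b * Complex.I))) atTop (𝓝 0) := by
    have h := ((hv (-1) (by simp)).const_mul Complex.I).sub ((hv 1 (by simp)).const_mul Complex.I)
    simp only [neg_mul, one_mul, mul_zero, sub_zero] at h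
    exact h.congr fun T => (hrect T).symm
  exact sub_eq_zero.1 (tendsto_nhds_unique hlim1 hlim2)

/-- The logistic weight `(e^{x/2} + e^{-x/2})⁻²`. -/
def wt (x : ℝ) : ℝ := Real.sigmoid x * (1 - Real.sigmoid x)

/-- The normalizing factor `e^{x/2} + e^{-x/2}`. -/
def chw (x : ℝ) : ℝ := Real.exp (x / 2) + Real.exp (-(x / 2))

lemma chw_pos (x : ℝ) : 0 < chw x := by unfold chw; positivity

lemma sigmoid_eq_chw (x : ℝ) : Real.sigmoid x = Real.exp (x / 2) / chw x := by
  have h : Real.exp (-x) = Real.exp (-(x / 2)) * Real.exp (-(x / 2)) := by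
    rw [← Real.exp_add]; congr 1; ring
  rw [Real.sigmoid_def, chw, h, Real.exp_neg]
  have := Real.exp_pos (x / 2)
  field_simp

lemma one_sub_sigmoid_eq_chw (x : ℝ) : 1 - Real.sigmoid x = Real.exp (-(x / 2)) / chw x := by
  rw [sigmoid_eq_chw, eq_div_iff (chw_pos x).ne', sub_mul, div_mul_cancel₀ _ (chw_pos x).ne', chw]
  ring

lemma wt_eq_chw (x : ℝ) : wt x = (chw x ^ 2)⁻¹ := by
  rw [wt, one_sub_sigmoid_eq_chw, sigmoid_eq_chw, div_mul_div_comm, ← Real.exp_add, add_neg_cancel,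
    Real.exp_zero, one_div, sq]

lemma wt_nonneg (x : ℝ) : 0 ≤ wt x := by rw [wt_eq_chw]; positivity

lemma exp_abs_le_chw (x : ℝ) : Real.exp (|x| / 2) ≤ chw x := by
  have h1 := Real.exp_pos (x / 2)
  have h2 := Real.exp_pos (-(x / 2))
  unfold chw
  rcases abs_choice x with h | h <;> rw [h]
  · linarith
  · rw [neg_div]; linarith

lemma wt_le (x : ℝ) : wt x ≤ Real.exp (-|x|) := by
  rw [wt_eq_chw, Real.exp_neg]
  refine inv_anti₀ (Real.exp_pos _) ?_
  calc Real.exp |x| = Real.exp (|x| / 2) ^ 2 := by rw [← Real.exp_nat_mul]; congr 1; push_cast; ring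
    _ ≤ chw x ^ 2 := pow_le_pow_left₀ (Real.exp_pos _).le (exp_abs_le_chw x) 2

lemma continuous_wt : Continuous wt :=
  continuous_sigmoid.mul (continuous_const.sub continuous_sigmoid)

/-- The density `(a - x)^k (e^{x/2} + e^{-x/2})⁻²`. -/
def rho (k : ℕ) (a : ℂ) (x : ℝ) : ℂ := (-(x : ℂ) + a) ^ k * (wt x : ℂ)

lemma continuous_rho (k : ℕ) (a : ℂ) : Continuous (rho k a) :=
  (by fun_prop : Continuous fun x : ℝ => (-(x : ℂ) + a) ^ k).mul
    (Complex.continuous_ofReal.comp continuous_wt)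

lemma integrable_of_decay {f : ℝ → ℂ} (hf : Continuous f) (C : ℝ)
    (h : ∀ x, ‖f x‖ ≤ C * (1 + x ^ 2)⁻¹) : Integrable f :=
  (integrable_inv_one_add_sq.const_mul C).mono' hf.aestronglyMeasurable (Eventually.of_forall h)

lemma integrable_rho (k : ℕ) (a : ℂ) : Integrable (rho k a) := by
  obtain ⟨C, _, hC⟩ := exists_decay_bound k ‖a‖ (norm_nonneg a)
  refine integrable_of_decay (continuous_rho k a) C fun x => le_trans ?_ (hC x)
  rw [rho, norm_mul, norm_pow, Complex.norm_real, Real.norm_of_nonneg (wt_nonneg x)]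
  have h : ‖-(x : ℂ) + a‖ ≤ |x| + ‖a‖ := by
    refine (norm_add_le _ _).trans ?_
    rw [norm_neg, Complex.norm_real, Real.norm_eq_abs]
  exact mul_le_mul (pow_le_pow_left₀ (norm_nonneg _) h k) (wt_le x) (wt_nonneg x) (by positivity)

/-! ### Bernoulli numbers as moments of the logistic distribution -/

/-- The moments of the logistic distribution, shifted by `a`. -/
def moment (k : ℕ) (a : ℂ) : ℂ := ∫ x : ℝ, rho k a x

lemma integral_wt : ∫ x : ℝ, wt x = 1 := by
  have hi : Integrable wt := by
    have := (integrable_rho 0 0).re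
    simpa [rho] using this
  exact (integral_of_hasDerivAt_of_tendsto (fun x => Real.hasDerivAt_sigmoid x) hi
    Real.tendsto_sigmoid_atBot Real.tendsto_sigmoid_atTop).trans (sub_zero 1)

lemma moment_zero (a : ℂ) : moment 0 a = 1 := by
  simp only [moment, rho, pow_zero, one_mul]
  rw [integral_complex_ofReal, integral_wt]
  norm_num

lemma moment_add (k : ℕ) (a b : ℂ) :
    moment k (a + b) = ∑ j ∈ Finset.range (k + 1), (k.choose j : ℂ) * b ^ (k - j) * moment j a := by
  simp only [moment]
  rw [Finset.sum_congr rfl fun j _ => (integral_const_mul ((k.choose j : ℂ) * b ^ (k - j)) (rho j a)).symm,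
    ← integral_finsetSum _ fun j _ => (integrable_rho j a).const_mul _]
  congr 1
  ext x
  rw [rho, ← add_assoc, add_pow, Finset.sum_mul]
  exact Finset.sum_congr rfl fun j _ => by rw [rho]; ring

/-- The difference `e^{z/2} - e^{-z/2}`. -/
def shw (z : ℂ) : ℂ := Complex.exp (z / 2) - Complex.exp (-(z / 2))

lemma differentiable_shw : Differentiable ℂ shw := by unfold shw; fun_prop

lemma shw_ne_zero {z : ℂ} (hz : z ≠ 0) (h1 : -Real.pi ≤ z.im) (h2 : z.im ≤ Real.pi) : shw z ≠ 0 := by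
  intro h
  have h3 : Complex.exp z = 1 := by
    have : Complex.exp z = Complex.exp (z / 2) * Complex.exp (z / 2) := by
      rw [← Complex.exp_add]; congr 1; ring
    rw [this]
    nth_rw 1 [sub_eq_zero.1 h]
    rw [← Complex.exp_add, neg_add_cancel, Complex.exp_zero]
  obtain ⟨n, hn⟩ := Complex.exp_eq_one_iff.1 h3
  have him : z.im = n * (2 * Real.pi) := by rw [hn]; simp
  have hpi := Real.pi_pos
  have hn0 : n = 0 := by
    rw [him] at h1 h2
    have a1 : (-1 : ℝ) < n := by nlinarith
    have a2 : (n : ℝ) < 1 := by nlinarith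
    have b1 : -1 < n := by exact_mod_cast a1
    have b2 : n < 1 := by exact_mod_cast a2
    omega
  exact hz (by rw [hn, hn0]; simp)

lemma le_norm_shw {x y : ℝ} (hx : 1 ≤ |x|) : Real.exp (|x| / 2) / 2 ≤ ‖shw (x + y * Complex.I)‖ := by
  have n1 : ‖Complex.exp ((x + y * Complex.I) / 2)‖ = Real.exp (x / 2) := by
    rw [Complex.norm_exp]; simp
  have n2 : ‖Complex.exp (-((x + y * Complex.I) / 2))‖ = Real.exp (-(x / 2)) := by
    rw [Complex.norm_exp]; simp
  have key : ∀ t : ℝ, 1 ≤ t → Real.exp (t / 2) / 2 ≤ Real.exp (t / 2) - Real.exp (-(t / 2)) := by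
    intro t ht
    have h2 : Real.exp (-(t / 2)) * Real.exp t = Real.exp (t / 2) := by rw [← Real.exp_add]; congr 1; ring
    have h3 : 2 ≤ Real.exp t := by have := Real.add_one_le_exp t; linarith
    have h4 := Real.exp_pos (-(t / 2))
    nlinarith
  have hle := abs_norm_sub_norm_le (Complex.exp ((x + y * Complex.I) / 2)) (Complex.exp (-((x + y * Complex.I) / 2)))
  rw [n1, n2] at hle
  refine le_trans ?_ hle
  rcases abs_choice x with h | h
  · rw [h]
    exact (key x (h ▸ hx)).trans (le_abs_self _)
  · rw [h]
    have := key (-x) (h ▸ hx)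
    rw [neg_div, neg_neg] at this
    rw [neg_div]
    exact this.trans (by rw [abs_sub_comm]; exact le_abs_self _)

/-- Both moments are integrals of -(-z)^k/(e^{z/2} - e^{-z/2})², along Im z = -π and Im z = π,
because e^{±πi/2} = ±i turns the denominator into -(e^{x/2} + e^{-x/2})². In the strip between, the
only pole is the double one at 0, cancelled by z^k as k ≥ 2. -/
lemma moment_pi_I_eq (k : ℕ) (hk : 2 ≤ k) :
    moment k (Real.pi * Complex.I) = moment k (-(Real.pi * Complex.I)) := by
  obtain ⟨m, rfl⟩ := Nat.exists_eq_add_of_le hk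
  -- E(z) = (e^{z/2} - e^{-z/2})/z with the singularity at 0 removed; F is written through E so as
  -- to be visibly holomorphic there.
  let E : ℂ → ℂ := dslope shw 0
  have hE : Differentiable ℂ E := by
    rw [← differentiableOn_univ]
    exact (Complex.differentiableOn_dslope univ_mem).2 differentiable_shw.differentiableOn
  have hEz : ∀ z, z ≠ 0 → E z = shw z / z := by
    intro z hz
    simp [E, dslope_of_ne _ hz, slope_def_field, shw]
  have hE0 : E 0 = 1 := by
    have : HasDerivAt shw 1 0 := by
      have h1 : HasDerivAt (fun z : ℂ => z / 2) (1 / 2) 0 := (hasDerivAt_id 0).div_const 2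
      have := h1.cexp.sub h1.neg.cexp
      convert! this using 1
      norm_num
    simp [E, this.deriv]
  have hne : ∀ z : ℂ, -Real.pi ≤ z.im → z.im ≤ Real.pi → E z ≠ 0 := by
    intro z h1 h2
    by_cases hz : z = 0
    · rw [hz, hE0]; exact one_ne_zero
    · rw [hEz z hz]; exact div_ne_zero (shw_ne_zero hz h1 h2) hz
  let F : ℂ → ℂ := fun z => -(-1) ^ m * z ^ m / E z ^ 2
  have hFz : ∀ z, z ≠ 0 → F z = -(-z) ^ (2 + m) / shw z ^ 2 := by
    intro z hz
    simp only [F, hEz z hz]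
    rw [div_pow, div_div_eq_mul_div]
    congr 1
    rw [neg_pow z, pow_add z, pow_add (-1 : ℂ)]
    ring
  have hF : ∀ s : ℂ, s = Complex.I ∨ s = -Complex.I → ∀ x : ℝ, F (x + Real.pi * s) =
      rho (2 + m) (-(Real.pi * s)) x := by
    intro s hs x
    have hs2 : s ^ 2 = -1 := by rcases hs with rfl | rfl <;> simp
    have hpi := Real.pi_ne_zero
    have hz : (x + Real.pi * s : ℂ) ≠ 0 := by
      intro h
      have := congrArg Complex.im h
      rcases hs with rfl | rfl <;> simp [hpi] at this
    have he : Complex.exp (Real.pi * s / 2) = s := by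
      rcases hs with rfl | rfl
      · rw [show (Real.pi * Complex.I / 2 : ℂ) = Real.pi / 2 * Complex.I by ring, Complex.exp_pi_div_two_mul_I]
      · rw [show (Real.pi * -Complex.I / 2 : ℂ) = -Real.pi / 2 * Complex.I by ring,
          Complex.exp_neg_pi_div_two_mul_I]
    have he' : Complex.exp (-(Real.pi * s / 2)) = -s := by
      rw [Complex.exp_neg, he]
      exact inv_eq_of_mul_eq_one_right (by linear_combination -hs2)
    have hsh : shw (x + Real.pi * s) = s * (chw x : ℂ) := by
      rw [shw, add_div, Complex.exp_add, neg_add, Complex.exp_add, he, he', chw]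
      push_cast
      ring
    rw [hFz _ hz, hsh, mul_pow, hs2, rho, wt_eq_chw]
    push_cast
    have hc : (chw x : ℂ) ≠ 0 := by exact_mod_cast (chw_pos x).ne'
    rw [neg_add]
    field_simp
  obtain ⟨C, hC0, hC⟩ := exists_decay_bound (2 + m) Real.pi Real.pi_pos.le
  have h := integral_horizontal_eq (F := F) (a := -Real.pi) (b := Real.pi) (C := 4 * C)
    (by linarith [Real.pi_pos])
    (fun z h1 h2 => DifferentiableAt.div (by fun_prop) ((hE z).pow 2) (pow_ne_zero _ (hne z h1 h2)))
    ?_ ?_ ?_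
  · rw [moment, moment]
    have e1 : ∀ x : ℝ, F (x + (-Real.pi : ℝ) * Complex.I) = rho (2 + m) (Real.pi * Complex.I) x := by
      intro x
      have := hF (-Complex.I) (Or.inr rfl) x
      simpa using this
    have e2 : ∀ x : ℝ, F (x + Real.pi * Complex.I) = rho (2 + m) (-(Real.pi * Complex.I)) x :=
      hF Complex.I (Or.inl rfl)
    simpa only [e1, e2] using h
  · have e1 : ∀ x : ℝ, F (x + (-Real.pi : ℝ) * Complex.I) = rho (2 + m) (Real.pi * Complex.I) x := by
      intro x
      have := hF (-Complex.I) (Or.inr rfl) x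
      simpa using this
    simp only [e1]
    exact integrable_rho _ _
  · simp only [hF Complex.I (Or.inl rfl)]
    exact integrable_rho _ _
  · intro x y hx h1 h2
    have hz : (x + y * Complex.I : ℂ) ≠ 0 := by
      intro h
      have := congrArg Complex.re h
      simp at this
      rw [this] at hx
      norm_num at hx
    have hn : ‖-(x + y * Complex.I : ℂ)‖ ≤ |x| + Real.pi := by
      rw [norm_neg]
      refine (norm_add_le _ _).trans ?_
      simp only [Complex.norm_real, norm_mul, Complex.norm_I, mul_one, Real.norm_eq_abs]
      have := abs_le.2 ⟨h1, h2⟩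
      linarith
    have hs : Real.exp |x| / 4 ≤ ‖shw (x + y * Complex.I)‖ ^ 2 := by
      calc Real.exp |x| / 4 = (Real.exp (|x| / 2) / 2) ^ 2 := by
            rw [div_pow, ← Real.exp_nat_mul]
            norm_num
            ring
        _ ≤ _ := pow_le_pow_left₀ (by positivity) (le_norm_shw hx) 2
    rw [hFz _ hz, norm_div, norm_neg, norm_pow, norm_pow]
    calc ‖-(x + y * Complex.I : ℂ)‖ ^ (2 + m) / ‖shw (x + y * Complex.I)‖ ^ 2
        ≤ (|x| + Real.pi) ^ (2 + m) / (Real.exp |x| / 4) := by gcongr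
      _ = 4 * ((|x| + Real.pi) ^ (2 + m) * Real.exp (-|x|)) := by
          rw [Real.exp_neg]; field_simp
      _ ≤ 4 * (C * (1 + x ^ 2)⁻¹) := mul_le_mul_of_nonneg_left (hC x) (by norm_num)
      _ = _ := by ring

/-- Expanding the moment of order k + 1 at πi around -πi, the top terms agree by `moment_pi_I_eq`.
What remains is the recurrence Σ_{j≤k} C(k+1, j) B_j = 0. -/
lemma moment_neg_pi_I (k : ℕ) :
    moment k (-(Real.pi * Complex.I)) = (2 * Real.pi * Complex.I) ^ k * ((bernoulli k : ℚ) : ℂ) := by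
  have hpi : (2 * Real.pi * Complex.I : ℂ) ≠ 0 := Complex.two_pi_I_ne_zero
  induction k using Nat.strong_induction_on with
  | _ k ih =>
    rcases Nat.eq_zero_or_pos k with rfl | hk
    · simp [moment_zero]
    have h1 := moment_add (k + 1) (-(Real.pi * Complex.I)) (2 * Real.pi * Complex.I)
    rw [show -(Real.pi * Complex.I : ℂ) + 2 * Real.pi * Complex.I = Real.pi * Complex.I by ring,
      moment_pi_I_eq (k + 1) (by omega), Finset.sum_range_succ, Finset.sum_range_succ] at h1
    simp only [Nat.choose_self, Nat.cast_one, Nat.sub_self, pow_zero, one_mul, Nat.choose_succ_self_right,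
      Nat.add_sub_cancel_left, pow_one] at h1
    have h2 : ∑ j ∈ Finset.range k, ((k + 1).choose j : ℂ) * (2 * Real.pi * Complex.I) ^ (k + 1 - j) *
        moment j (-(Real.pi * Complex.I)) = (2 * Real.pi * Complex.I) ^ (k + 1) *
          ∑ j ∈ Finset.range k, ((k + 1).choose j : ℂ) * ((bernoulli j : ℚ) : ℂ) := by
      rw [Finset.mul_sum]
      refine Finset.sum_congr rfl fun j hj => ?_
      have hj' := Finset.mem_range.1 hj
      rw [ih j hj', show k + 1 = (k + 1 - j) + j by omega, pow_add]
      simp only [Nat.add_sub_cancel]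
      ring
    have h3 := sum_bernoulli (k + 1)
    rw [if_neg (by omega), Finset.sum_range_succ, Nat.choose_succ_self_right] at h3
    have h3' := congrArg (fun q : ℚ => (q : ℂ)) h3
    push_cast at h3'
    rw [h2] at h1
    have hk1 : ((k + 1 : ℕ) : ℂ) ≠ 0 := by exact_mod_cast k.succ_ne_zero
    have h4 : (((k + 1 : ℕ) : ℂ) * (2 * Real.pi * Complex.I)) * moment k (-(Real.pi * Complex.I)) =
        (((k + 1 : ℕ) : ℂ) * (2 * Real.pi * Complex.I)) *
          ((2 * Real.pi * Complex.I) ^ k * ((bernoulli k : ℚ) : ℂ)) := by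
      push_cast at h1 ⊢
      linear_combination -h1 - (2 * Real.pi * Complex.I) ^ (k + 1) * h3'
    exact mul_left_cancel₀ (mul_ne_zero hk1 hpi) h4

/-- The two shifts differ only in order 1, exactly where `bernoulli` and `bernoulli'` do. -/
lemma moment_pi_I (k : ℕ) :
    moment k (Real.pi * Complex.I) = (2 * Real.pi * Complex.I) ^ k * ((bernoulli' k : ℚ) : ℂ) := by
  rcases lt_or_ge k 2 with hk | hk
  · interval_cases k
    · simp [moment_zero]
    · have h := moment_add 1 (-(Real.pi * Complex.I)) (2 * Real.pi * Complex.I)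
      rw [show -(Real.pi * Complex.I : ℂ) + 2 * Real.pi * Complex.I = Real.pi * Complex.I by ring] at h
      rw [h, Finset.sum_range_succ, Finset.sum_range_one, moment_zero, moment_neg_pi_I]
      simp [bernoulli_one, bernoulli'_one]
      ring
  · rw [moment_pi_I_eq k hk, moment_neg_pi_I, bernoulli_eq_bernoulli'_of_ne_one (by omega)]

/-! ### Integrals of inverse determinants along segments -/

/-- An entry of `(1 - s) Z₂ + s Z₁`, as a continuous function of `s ∈ [0, 1]`. -/
def segEntry (i j : Fin 2) : HC × HC →ₗ[ℂ] C(unitInterval, ℂ) where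
  toFun P := ⟨fun s => P.2 i j * (1 - (s : ℂ)) + P.1 i j * (s : ℂ), by fun_prop⟩
  map_add' P Q := by
    ext s
    simp only [Prod.snd_add, Prod.fst_add, Matrix.add_apply, ContinuousMap.coe_mk,
      ContinuousMap.add_apply]
    ring
  map_smul' c P := by
    ext s
    simp only [Prod.smul_snd, Prod.smul_fst, Matrix.smul_apply, smul_eq_mul, ContinuousMap.coe_mk,
      ContinuousMap.smul_apply, RingHom.id_apply]
    ring

/-- The determinant of `(1 - s) Z₂ + s Z₁`, as a continuous function of `s ∈ [0, 1]`. -/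
def segDet (P : HC × HC) : C(unitInterval, ℂ) :=
  segEntry 0 0 P * segEntry 1 1 P - segEntry 0 1 P * segEntry 1 0 P

lemma segDet_apply (P : HC × HC) (s : unitInterval) :
    segDet P s = ((1 - (s : ℂ)) • P.2 + (s : ℂ) • P.1).det := by
  simp [segDet, segEntry, Matrix.det_fin_two]
  ring

lemma analyticAt_segDet (P : HC × HC) : AnalyticAt ℂ segDet P := by
  have h : ∀ i j, AnalyticAt ℂ (segEntry i j) P := fun i j =>
    (LinearMap.toContinuousLinearMap (segEntry i j)).analyticAt P
  exact ((h 0 0).mul (h 1 1)).sub ((h 0 1).mul (h 1 0))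

/-- Pairs of matrices for which the whole segment consists of invertible matrices. -/
def segSet : Set (HC × HC) := {P | IsUnit (segDet P)}

lemma mem_segSet {P : HC × HC} :
    P ∈ segSet ↔ ∀ s : unitInterval, ((1 - (s : ℂ)) • P.2 + (s : ℂ) • P.1).det ≠ 0 := by
  simp only [segSet, Set.mem_ofPred_eq, ContinuousMap.isUnit_iff_forall_ne_zero, segDet_apply]

lemma isOpen_segSet : IsOpen segSet :=
  Units.isOpen.preimage (continuous_iff_continuousAt.2 fun P => (analyticAt_segDet P).continuousAt)

/-- The integral `∫ ρ(x) det((1 - σ(x)) Z₂ + σ(x) Z₁)⁻¹ dx`, `σ` the logistic function. -/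
def kerInt (ρ : ℝ → ℂ) (P : HC × HC) : ℂ :=
  ∫ x : ℝ, ρ x * ((1 - (Real.sigmoid x : ℂ)) • P.2 + (Real.sigmoid x : ℂ) • P.1).det⁻¹

lemma integrable_mul_comp_sigmoid {ρ : ℝ → ℂ} (hρ : Integrable ρ) (f : C(unitInterval, ℂ)) :
    Integrable fun x => ρ x * f (unitInterval.sigmoid x) :=
  hρ.mul_bdd (c := ‖f‖) (f.continuous.comp unitInterval.continuous_sigmoid).aestronglyMeasurable
    (Eventually.of_forall fun _ => f.norm_coe_le_norm _)

/-- Integration against `ρ` after pulling back by the logistic function. -/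
def sigmoidFunctional {ρ : ℝ → ℂ} (hρ : Integrable ρ) : C(unitInterval, ℂ) →L[ℂ] ℂ :=
  LinearMap.mkContinuous
    { toFun := fun f => ∫ x, ρ x * f (unitInterval.sigmoid x)
      map_add' := fun f g => by
        rw [← integral_add (integrable_mul_comp_sigmoid hρ f) (integrable_mul_comp_sigmoid hρ g)]
        simp only [ContinuousMap.add_apply, mul_add]
      map_smul' := fun c f => by
        rw [RingHom.id_apply, smul_eq_mul, ← integral_const_mul]
        simp only [ContinuousMap.smul_apply, smul_eq_mul, mul_left_comm] }
    (∫ x, ‖ρ x‖) fun f => by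
      rw [← integral_mul_const]
      refine norm_integral_le_of_norm_le (hρ.norm.mul_const _) (Eventually.of_forall fun x => ?_)
      rw [norm_mul]
      exact mul_le_mul_of_nonneg_left (f.norm_coe_le_norm _) (norm_nonneg _)

lemma ringInverse_segDet_apply {P : HC × HC} (hP : P ∈ segSet) (s : unitInterval) :
    (Ring.inverse (segDet P)) s = ((1 - (s : ℂ)) • P.2 + (s : ℂ) • P.1).det⁻¹ := by
  have h : (Ring.inverse (segDet P) * segDet P) s = 1 := by
    rw [Ring.inverse_mul_cancel _ hP]; rfl
  rw [ContinuousMap.mul_apply, segDet_apply] at h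
  exact eq_inv_of_mul_eq_one_left h

lemma integrable_kerInt {ρ : ℝ → ℂ} (hρ : Integrable ρ) {P : HC × HC} (hP : P ∈ segSet) :
    Integrable fun x => ρ x * ((1 - (Real.sigmoid x : ℂ)) • P.2 + (Real.sigmoid x : ℂ) • P.1).det⁻¹ := by
  have := integrable_mul_comp_sigmoid hρ (Ring.inverse (segDet P))
  simp only [ringInverse_segDet_apply hP] at this
  exact this

/-- Everything takes place in the Banach algebra of continuous functions on [0, 1]: `kerInt` is a
polynomial map into it, followed by inversion, which is analytic on units, and by a bounded linear
functional. No differentiation under the integral sign is needed. -/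
lemma analyticAt_kerInt {ρ : ℝ → ℂ} (hρ : Integrable ρ) {P : HC × HC} (hP : P ∈ segSet) :
    AnalyticAt ℂ (kerInt ρ) P := by
  have h1 : AnalyticAt ℂ (fun Q => sigmoidFunctional hρ (Ring.inverse (segDet Q))) P :=
    ((sigmoidFunctional hρ).analyticAt _).comp
      ((analyticOnNhd_inverse (𝕜 := ℂ) (segDet P) hP).comp (analyticAt_segDet P))
  refine h1.congr ?_
  filter_upwards [isOpen_segSet.mem_nhds hP] with Q hQ
  change ∫ x, ρ x * (Ring.inverse (segDet Q)) (unitInterval.sigmoid x) = _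
  simp only [ringInverse_segDet_apply hQ]
  rfl

lemma kerInt_diag (ρ : ℝ → ℂ) (Z : HC) : kerInt ρ (Z, Z) = (∫ x, ρ x) * Z.det⁻¹ := by
  rw [kerInt, ← integral_mul_const]
  simp only [← add_smul, sub_add_cancel, one_smul]

lemma diag_mem_segSet (Z : HCx) : ((Z : HC), (Z : HC)) ∈ segSet := by
  rw [mem_segSet]
  intro s
  rw [← add_smul, sub_add_cancel, one_smul]
  exact ((Matrix.isUnit_iff_isUnit_det _).1 Z.isUnit).ne_zero

lemma det_ne_zero_of_mem_segSet {P : HC × HC} (hP : P ∈ segSet) : P.1.det ≠ 0 ∧ P.2.det ≠ 0 := by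
  rw [mem_segSet] at hP
  refine ⟨?_, ?_⟩
  · simpa using hP 1
  · simpa using hP 0

/-! ### Spectral conditions -/

lemma mem_spectrum_of_det {M : HC} {z : ℂ} (h : (z • (1 : HC) - M).det = 0) : z ∈ spectrum ℂ M := by
  rw [spectrum.mem_iff, Algebra.algebraMap_eq_smul_one, Matrix.isUnit_iff_isUnit_det, h]
  exact not_isUnit_zero

lemma det_smul_sub_smul {A B : HC} (hB : B.det ≠ 0) {l₁ l₂ : ℂ}
    (hl : ∀ z : ℂ, (z • (1 : HC) - A * B⁻¹).det = (z - l₁) * (z - l₂)) (α : ℂ) {β : ℂ} (hβ : β ≠ 0) :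
    (α • B - β • A).det = B.det * ((α - β * l₁) * (α - β * l₂)) := by
  have h : α • B - β • A = (β • ((α / β) • (1 : HC) - A * B⁻¹)) * B := by
    rw [Matrix.smul_mul, Matrix.sub_mul, Matrix.mul_assoc,
      Matrix.nonsing_inv_mul _ (isUnit_iff_ne_zero.2 hB), Matrix.mul_one, Matrix.smul_mul,
      Matrix.one_mul, smul_sub, smul_smul, mul_div_cancel₀ _ hβ]
  rw [h, Matrix.det_mul, Matrix.det_smul, hl]
  simp only [Fintype.card_fin]
  field_simp

/-- For a, b > 0 a vanishing determinant would make a/b an eigenvalue of Z₁Z₂⁻¹; if a or b is 0,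
invertibility of Z₁ or Z₂ is enough. This puts the segment from Z₂ to -Z₁ inside the invertible
matrices. -/
lemma det_ne_zero_of_mem_Ω {P : HC × HC} (hP : P ∈ Ω) {a b : ℝ} (ha : 0 ≤ a) (hb : 0 ≤ b)
    (hab : a ≠ 0 ∨ b ≠ 0) : ((a : ℂ) • P.2 - (b : ℂ) • P.1).det ≠ 0 := by
  obtain ⟨h1, h2, h3⟩ := hP
  rcases hb.eq_or_lt with rfl | hb
  · have ha' : (a : ℂ) ≠ 0 := by exact_mod_cast hab.resolve_right (by simp)
    simpa [Matrix.det_smul, ha'] using h2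
  have hb' : (b : ℂ) ≠ 0 := by exact_mod_cast hb.ne'
  rcases ha.eq_or_lt with rfl | ha
  · simpa [det_neg_HC, Matrix.det_smul, hb'] using h1
  obtain ⟨l₁, l₂, hl, -⟩ := exists_eigenvalues (P.1 * P.2⁻¹)
  rw [det_smul_sub_smul h2 hl _ hb']
  have hn : ∀ l : ℂ, (l • (1 : HC) - P.1 * P.2⁻¹).det = 0 → (a : ℂ) - b * l ≠ 0 := by
    intro l h0 h
    refine h3 l (mem_spectrum_of_det h0) ⟨a / b, by positivity, ?_⟩
    push_cast
    rw [eq_div_iff hb']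
    linear_combination -h
  exact mul_ne_zero h2 (mul_ne_zero (hn l₁ (by rw [hl]; ring)) (hn l₂ (by rw [hl]; ring)))

lemma neg_fst_mem_segSet {P : HC × HC} (hP : P ∈ Ω) : (-P.1, P.2) ∈ segSet := by
  rw [mem_segSet]
  intro s
  have := det_ne_zero_of_mem_Ω hP (a := 1 - s) (b := s) (by linarith [s.2.2]) s.2.1 (by
    by_contra! h
    linarith [h.1, h.2])
  simpa [sub_eq_add_neg] using this

lemma neg_snd_mem_segSet {P : HC × HC} (hP : P ∈ Ω) : (P.1, -P.2) ∈ segSet := by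
  have h := mem_segSet.1 (neg_fst_mem_segSet hP)
  rw [mem_segSet]
  intro s
  have := h s
  rw [← det_neg_HC] at this
  simpa [neg_add_rev, add_comm] using this

lemma swap_neg_mem_segSet {P : HC × HC} (hP : P ∈ Ω) : (P.2, -P.1) ∈ segSet := by
  have h := mem_segSet.1 (neg_fst_mem_segSet hP)
  rw [mem_segSet]
  intro s
  have := h (unitInterval.symm s)
  simpa [add_comm] using this

/-! ### Summation of the mixed parts -/

/-- The determinant is homogeneous of degree 2, so the weight is absorbed by rescaling with e^{x/2}
+ e^{-x/2}. The left form suits analyticity, the right one series and contour shifts. -/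
lemma wt_mul_det_inv (x : ℝ) (A B : HC) :
    (wt x : ℂ) * ((1 - (Real.sigmoid x : ℂ)) • B + (Real.sigmoid x : ℂ) • A).det⁻¹ =
      ((Real.exp (-(x / 2)) : ℂ) • B + (Real.exp (x / 2) : ℂ) • A).det⁻¹ := by
  have hc : (chw x : ℂ) ≠ 0 := by exact_mod_cast (chw_pos x).ne'
  have h1 : (1 - (Real.sigmoid x : ℂ)) = (chw x : ℂ)⁻¹ * (Real.exp (-(x / 2)) : ℂ) := by
    have := one_sub_sigmoid_eq_chw x
    rw [div_eq_inv_mul] at this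
    exact_mod_cast this
  have h2 : (Real.sigmoid x : ℂ) = (chw x : ℂ)⁻¹ * (Real.exp (x / 2) : ℂ) := by
    have := sigmoid_eq_chw x
    rw [div_eq_inv_mul] at this
    exact_mod_cast this
  rw [h1, h2, mul_smul, mul_smul, ← smul_add, Matrix.det_smul, wt_eq_chw]
  push_cast
  simp only [Fintype.card_fin, mul_inv, inv_pow, inv_inv]
  field_simp

/-- The part of the kernel integral over `x > 0`. -/
def halfInt (k : ℕ) : HC × HC → ℂ := kerInt (Set.indicator (Set.Ioi 0) (rho k 0))

lemma integrable_indicator_rho (k : ℕ) : Integrable (Set.indicator (Set.Ioi 0) (rho k 0)) :=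
  (integrable_rho k 0).indicator measurableSet_Ioi

lemma halfInt_eq (k : ℕ) (A B : HC) :
    halfInt k (A, B) = ∫ x in Set.Ioi (0 : ℝ), (-(x : ℂ)) ^ k *
      ((Real.exp (-(x / 2)) : ℂ) • B + (Real.exp (x / 2) : ℂ) • A).det⁻¹ := by
  rw [halfInt, kerInt, ← integral_indicator measurableSet_Ioi]
  congr 1
  ext x
  by_cases hx : x ∈ Set.Ioi (0 : ℝ)
  · rw [Set.indicator_of_mem hx, Set.indicator_of_mem hx, rho, add_zero, mul_assoc, wt_mul_det_inv]
  · rw [Set.indicator_of_notMem hx, Set.indicator_of_notMem hx, zero_mul]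

lemma integral_pow_mul_exp (k L : ℕ) :
    ∫ x in Set.Ioi (0 : ℝ), x ^ k * Real.exp (-((L + 1) * x)) = k.factorial / (L + 1) ^ (k + 1) := by
  have h := Real.integral_rpow_mul_exp_neg_mul_Ioi (a := k + 1) (r := L + 1) (by positivity) (by positivity)
  rw [Real.Gamma_nat_eq_factorial] at h
  simp only [add_sub_cancel_right, Real.rpow_natCast] at h
  rw [h, show ((k : ℝ) + 1) = ((k + 1 : ℕ) : ℝ) by push_cast; ring, Real.rpow_natCast, one_div, inv_pow]
  ring

lemma integrableOn_pow_mul_exp (k L : ℕ) :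
    IntegrableOn (fun x : ℝ => x ^ k * Real.exp (-((L + 1) * x))) (Set.Ioi 0) := by
  -- A nonintegrable function would have integral 0, whereas the value just computed is positive.
  by_contra h
  have h0 := integral_undef h
  rw [integral_pow_mul_exp] at h0
  have : (0 : ℝ) < k.factorial / ((L : ℝ) + 1) ^ (k + 1) := by positivity
  exact this.ne' h0

lemma norm_eigenvalue_lt_one {A B : HC} (h : (B * Bᴴ - A * Aᴴ).PosDef) (hB : B.det ≠ 0) {l : ℂ}
    (hl : (l • (1 : HC) - A * B⁻¹).det = 0) : ‖l‖ < 1 := by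
  by_contra! hn
  have hl0 : l ≠ 0 := by
    rintro rfl
    norm_num at hn
  refine det_sub_smul_ne_zero h (u := l⁻¹) (by rw [norm_inv]; exact inv_le_one_of_one_le₀ hn) ?_
  have : B - l⁻¹ • A = (l⁻¹ • (l • (1 : HC) - A * B⁻¹)) * B := by
    rw [Matrix.smul_mul, Matrix.sub_mul, Matrix.mul_assoc,
      Matrix.nonsing_inv_mul _ (isUnit_iff_ne_zero.2 hB), Matrix.mul_one, Matrix.smul_mul,
      Matrix.one_mul, smul_sub, smul_smul, inv_mul_cancel₀ hl0, one_smul]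
  rw [this, Matrix.det_mul, Matrix.det_smul, hl]
  ring

/-- With r = e^{-x}, the geometric series in the eigenvalues of AB⁻¹ multiply to Σ r^L χ_L = ((1 -
rl₁)(1 - rl₂))⁻¹. Integration against x^k e^{-x} termwise is justified because |l₁|, |l₂| < 1 makes
Σ|χ_L| finite. -/
lemma hasSum_halfInt (k : ℕ) {A B : HC} (h : (B * Bᴴ - A * Aᴴ).PosDef) (hB : B.det ≠ 0) :
    HasSum (fun L : ℕ => (-1) ^ k * (k.factorial / ((L : ℂ) + 1) ^ (k + 1)) *
      (B.det⁻¹ * (tMat L (A * B⁻¹)).trace)) (halfInt k (B, -A)) := by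
  obtain ⟨l₁, l₂, hl, htr⟩ := exists_eigenvalues (A * B⁻¹)
  have n1 : ‖l₁‖ < 1 := norm_eigenvalue_lt_one h hB (by rw [hl]; ring)
  have n2 : ‖l₂‖ < 1 := norm_eigenvalue_lt_one h hB (by rw [hl]; ring)
  set χ : ℕ → ℂ := fun L => (tMat L (A * B⁻¹)).trace with hχ
  have hχsum : Summable fun L => ‖χ L‖ := by
    simp only [hχ, htr]
    exact summable_norm_sum_mul_range_of_summable_norm
      (f := fun n => l₁ ^ n) (g := fun n => l₂ ^ n)
      (summable_norm_geometric_of_norm_lt_one n1) (summable_norm_geometric_of_norm_lt_one n2)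
  let F : ℕ → ℝ → ℂ := fun L x => ((-1) ^ k * (B.det⁻¹ * χ L)) * ((x ^ k * Real.exp (-((L + 1) * x)) : ℝ) : ℂ)
  have hFint : ∀ L, Integrable (F L) (volume.restrict (Set.Ioi 0)) := fun L =>
    (integrableOn_pow_mul_exp k L).ofReal.const_mul _
  have hFval : ∀ L, ∫ x in Set.Ioi (0 : ℝ), F L x =
      (-1) ^ k * (k.factorial / ((L : ℂ) + 1) ^ (k + 1)) * (B.det⁻¹ * χ L) := by
    intro L
    simp only [F]
    rw [integral_const_mul, integral_complex_ofReal, integral_pow_mul_exp]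
    push_cast
    ring
  have hFnorm : ∀ L, ∫ x in Set.Ioi (0 : ℝ), ‖F L x‖ =
      ‖B.det⁻¹‖ * ‖χ L‖ * (k.factorial / ((L : ℝ) + 1) ^ (k + 1)) := by
    intro L
    rw [← integral_pow_mul_exp, ← integral_const_mul]
    refine setIntegral_congr_fun measurableSet_Ioi fun x hx => ?_
    have hx' : (0 : ℝ) < x := hx
    simp only [F, norm_mul, norm_pow, norm_neg, norm_one, one_pow, one_mul, Complex.norm_real]
    rw [Real.norm_of_nonneg hx'.le, Real.norm_of_nonneg (Real.exp_pos _).le]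
  have hFsum : Summable fun L => ∫ x in Set.Ioi (0 : ℝ), ‖F L x‖ := by
    simp only [hFnorm]
    refine Summable.of_nonneg_of_le (fun L => by positivity) (fun L => ?_)
      ((hχsum.mul_left ‖B.det⁻¹‖).mul_right (k.factorial : ℝ))
    gcongr
    refine div_le_self (by positivity) (one_le_pow₀ ?_)
    have : (0 : ℝ) ≤ L := L.cast_nonneg
    linarith
  have key := hasSum_integral_of_summable_integral_norm hFint hFsum
  simp only [hFval] at key
  convert! key using 1
  rw [halfInt_eq]
  refine setIntegral_congr_fun measurableSet_Ioi fun x hx => ?_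
  have hx' : (0 : ℝ) < x := hx
  set r : ℂ := (Real.exp (-x) : ℂ) with hr
  have hr1 : ‖r‖ < 1 := by
    rw [hr, Complex.norm_real, Real.norm_of_nonneg (Real.exp_pos _).le]
    rw [← Real.exp_zero]
    exact Real.exp_lt_exp.2 (by linarith)
  have hr0 : r ≠ 0 := by rw [hr]; exact_mod_cast (Real.exp_pos _).ne'
  have m1 : ‖r * l₁‖ < 1 := by
    rw [norm_mul]; exact mul_lt_one_of_nonneg_of_lt_one_left (norm_nonneg _) hr1 n1.le
  have m2 : ‖r * l₂‖ < 1 := by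
    rw [norm_mul]; exact mul_lt_one_of_nonneg_of_lt_one_left (norm_nonneg _) hr1 n2.le
  have hgeo := hasSum_sum_range_mul_of_summable_norm
    (summable_norm_geometric_of_norm_lt_one m1) (summable_norm_geometric_of_norm_lt_one m2)
  rw [tsum_geometric_of_norm_lt_one m1, tsum_geometric_of_norm_lt_one m2] at hgeo
  have hterm : ∀ L, F L x = ((-1) ^ k * x ^ k * B.det⁻¹ * r) *
      ∑ j ∈ Finset.range (L + 1), (r * l₁) ^ j * (r * l₂) ^ (L - j) := by
    intro L
    have e1 : ∑ j ∈ Finset.range (L + 1), (r * l₁) ^ j * (r * l₂) ^ (L - j) = r ^ L * χ L := by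
      simp only [hχ, htr, Finset.mul_sum]
      refine Finset.sum_congr rfl fun j hj => ?_
      have : L = j + (L - j) := by have := Finset.mem_range.1 hj; omega
      rw [mul_pow, mul_pow]
      nth_rw 3 [this]
      rw [pow_add]
      ring
    have e2 : ((Real.exp (-((L + 1) * x)) : ℝ) : ℂ) = r * r ^ L := by
      rw [hr]
      norm_cast
      rw [← Real.exp_nat_mul, ← Real.exp_add]
      congr 1
      push_cast
      ring
    rw [e1]
    simp only [F]
    rw [Complex.ofReal_mul, e2]
    push_cast
    ring
  have htsum := (hgeo.mul_left ((-1) ^ k * x ^ k * B.det⁻¹ * r)).tsum_eq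
  simp only [← hterm] at htsum
  refine Eq.trans ?_ htsum.symm
  have hE : (Real.exp (x / 2) : ℂ) ≠ 0 := by exact_mod_cast (Real.exp_pos _).ne'
  have hrE : (Real.exp (-(x / 2)) : ℂ) = Real.exp (x / 2) * r := by
    rw [hr]; norm_cast; rw [← Real.exp_add]; congr 1; ring
  have hd : ((Real.exp (-(x / 2)) : ℂ) • -A + (Real.exp (x / 2) : ℂ) • B).det =
      (Real.exp (x / 2) : ℂ) ^ 2 * (B.det * ((1 - r * l₁) * (1 - r * l₂))) := by
    have := det_smul_sub_smul hB hl 1 hr0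
    rw [one_smul] at this
    rw [← this, hrE, mul_smul, ← smul_add, Matrix.det_smul, smul_neg, neg_add_eq_sub]
    simp
  have hr2 : r = ((Real.exp (x / 2) : ℂ) ^ 2)⁻¹ := by
    rw [hr]; norm_cast; rw [← Real.exp_nat_mul, ← Real.exp_neg]; congr 1; push_cast; ring
  rw [hd]
  simp only [mul_inv]
  rw [← hr2, neg_pow]
  ring

/-! ### Contour shift to the diagonal -/

lemma exists_lower_bound {l : ℂ} {η : ℝ} (hη : |η| = 1) (hl : 0 < η * l.im) :
    ∃ c : ℝ, 0 < c ∧ ∀ x y : ℝ, 0 ≤ η * Real.sin y →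
      c * chw x ≤ ‖Complex.exp (-((x + y * Complex.I) / 2)) - Complex.exp ((x + y * Complex.I) / 2) * l‖ := by
  set d := η * l.im with hd
  -- With u = e^{-z}, the imaginary parts give |u - l| ≥ d, and |u| ≤ |u - l| + |l|; together d(1 +
  -- |u|) ≤ (d + 1 + |l|)|u - l|.
  refine ⟨d / (d + (1 + ‖l‖)), by positivity, fun x y hy => ?_⟩
  set u := Complex.exp (-(x + y * Complex.I)) with hu
  have hu1 : ‖u‖ = Real.exp (-x) := by rw [hu, Complex.norm_exp]; simp
  have huim : u.im = -(Real.exp (-x) * Real.sin y) := by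
    rw [hu, Complex.exp_im]; simp
  have hfac : Complex.exp (-((x + y * Complex.I) / 2)) - Complex.exp ((x + y * Complex.I) / 2) * l =
      Complex.exp ((x + y * Complex.I) / 2) * (u - l) := by
    rw [mul_sub, hu, ← Complex.exp_add]
    congr 2
    ring
  have hE : ‖Complex.exp ((x + y * Complex.I) / 2)‖ = Real.exp (x / 2) := by
    rw [Complex.norm_exp]; simp
  have h1 : d ≤ ‖u - l‖ := by
    have h2 : |(u - l).im| ≤ ‖u - l‖ := Complex.abs_im_le_norm _
    have h3 : -(η * (u - l).im) ≤ |(u - l).im| := by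
      rw [← one_mul |(u - l).im|, ← hη, ← abs_mul]
      exact neg_le_abs _
    rw [Complex.sub_im, huim] at h3
    have h4 : 0 ≤ Real.exp (-x) * (η * Real.sin y) := mul_nonneg (Real.exp_pos _).le hy
    rw [Complex.sub_im, huim] at h2
    linarith [h3, h2]
  have h2 : ‖u‖ ≤ ‖u - l‖ + ‖l‖ := by
    have := norm_add_le (u - l) l
    rwa [sub_add_cancel] at this
  have hch : chw x = Real.exp (x / 2) * (1 + Real.exp (-x)) := by
    rw [chw, mul_add, mul_one, ← Real.exp_add]
    congr 2
    ring
  rw [hfac, norm_mul, hE, hch, mul_left_comm]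
  refine mul_le_mul_of_nonneg_left ?_ (Real.exp_pos _).le
  rw [← hu1, div_mul_eq_mul_div, div_le_iff₀ (by positivity)]
  nlinarith [norm_nonneg l, norm_nonneg (u - l)]

/-- The sign attached to `Λ⁺` and `Λ⁻`. -/
def sgn (s : Bool) : ℝ := if s then 1 else -1

lemma im_pos_of_mem_Λ {s : Bool} {P : HC × HC} (hP : P ∈ Λ s) :
    P.1.det ≠ 0 ∧ P.2.det ≠ 0 ∧ ∀ z ∈ spectrum ℂ (P.1 * P.2⁻¹), 0 < sgn s * z.im := by
  cases s
  · refine ⟨hP.1, hP.2.1, fun z hz => ?_⟩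
    have := hP.2.2 z hz
    simp only [sgn, Bool.false_eq_true, if_false]
    linarith
  · refine ⟨hP.1, hP.2.1, fun z hz => ?_⟩
    have := hP.2.2 z hz
    simp only [sgn, if_true]
    linarith

lemma Λ_subset_Ω (s : Bool) : Λ s ⊆ Ω := by
  intro P hP
  obtain ⟨h1, h2, h3⟩ := im_pos_of_mem_Λ hP
  refine ⟨h1, h2, fun z hz => ?_⟩
  rintro ⟨r, -, rfl⟩
  have := h3 _ hz
  simp at this

/-- On Λ^± the lower bounds from `exists_lower_bound` keep D(z) away from 0 on the whole strip
between Im z = 0 and Im z = ±π, and provide the decay. Moving the line across it turns (-x)^k into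
(-x ∓ πi)^k. -/
lemma kerInt_shift (k : ℕ) {s : Bool} {P : HC × HC} (hP : P ∈ Λ s) (hseg : P ∈ segSet) :
    kerInt (rho k 0) (-P.1, P.2) = -kerInt (rho k (-(sgn s * Real.pi * Complex.I))) P := by
  obtain ⟨-, h2, hspec⟩ := im_pos_of_mem_Λ hP
  obtain ⟨l₁, l₂, hl, -⟩ := exists_eigenvalues (P.1 * P.2⁻¹)
  have hs1 : |sgn s| = 1 := by cases s <;> simp [sgn]
  obtain ⟨c₁, hc₁, hb₁⟩ := exists_lower_bound hs1 (hspec l₁ (mem_spectrum_of_det (by rw [hl]; ring)))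
  obtain ⟨c₂, hc₂, hb₂⟩ := exists_lower_bound hs1 (hspec l₂ (mem_spectrum_of_det (by rw [hl]; ring)))
  let D : ℂ → ℂ := fun z => (Complex.exp (-(z / 2)) • P.2 - Complex.exp (z / 2) • P.1).det
  have hDd : Differentiable ℂ D := by
    simp only [D, Matrix.det_fin_two, Matrix.sub_apply, Matrix.smul_apply, smul_eq_mul]
    fun_prop
  have hD : ∀ x y : ℝ, 0 ≤ sgn s * Real.sin y →
      ‖P.2.det‖ * (c₁ * c₂) * chw x ^ 2 ≤ ‖D (x + y * Complex.I)‖ := by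
    intro x y hy
    simp only [D]
    rw [det_smul_sub_smul h2 hl _ (Complex.exp_ne_zero _), norm_mul, norm_mul]
    calc ‖P.2.det‖ * (c₁ * c₂) * chw x ^ 2 = ‖P.2.det‖ * ((c₁ * chw x) * (c₂ * chw x)) := by ring
      _ ≤ _ := by
        have := chw_pos x
        have g1 := hb₁ x y hy
        have g2 := hb₂ x y hy
        gcongr
  have hK : 0 < ‖P.2.det‖ * (c₁ * c₂) := mul_pos (norm_pos_iff.2 h2) (mul_pos hc₁ hc₂)
  have hDne : ∀ x y : ℝ, 0 ≤ sgn s * Real.sin y → D (x + y * Complex.I) ≠ 0 := by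
    intro x y hy h0
    have := hD x y hy
    rw [h0, norm_zero] at this
    have := chw_pos x
    have : 0 < ‖P.2.det‖ * (c₁ * c₂) * chw x ^ 2 := by positivity
    linarith
  let F : ℂ → ℂ := fun z => (-z) ^ k * (D z)⁻¹
  have e0 : ∀ x : ℝ, F (x + (0 : ℝ) * Complex.I) = rho k 0 x *
      ((1 - (Real.sigmoid x : ℂ)) • P.2 + (Real.sigmoid x : ℂ) • -P.1).det⁻¹ := by
    intro x
    rw [rho, mul_assoc, wt_mul_det_inv]
    simp only [F, D, Complex.ofReal_zero, zero_mul, add_zero, smul_neg, ← sub_eq_add_neg]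
    push_cast
    rfl
  have e1 : ∀ x : ℝ, F (x + (sgn s * Real.pi : ℝ) * Complex.I) =
      -(rho k (-(sgn s * Real.pi * Complex.I)) x *
      ((1 - (Real.sigmoid x : ℂ)) • P.2 + (Real.sigmoid x : ℂ) • P.1).det⁻¹) := by
    intro x
    -- u = e^{±πi/2} = ±i. The matrix acquires the factor -u and the combination Z₂ + Z₁ appears;
    -- the determinant acquires u² = -1.
    obtain ⟨u, hu, hu1, hu2⟩ : ∃ u : ℂ, u ^ 2 = -1 ∧ Complex.exp (sgn s * Real.pi * Complex.I / 2) = u ∧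
        Complex.exp (-(sgn s * Real.pi * Complex.I / 2)) = -u := by
      cases s
      · refine ⟨-Complex.I, by simp, ?_, ?_⟩
        · rw [← Complex.exp_neg_pi_div_two_mul_I]; congr 1; simp [sgn]; ring
        · rw [neg_neg, ← Complex.exp_pi_div_two_mul_I]; congr 1; simp [sgn]; ring
      · refine ⟨Complex.I, by simp, ?_, ?_⟩
        · rw [← Complex.exp_pi_div_two_mul_I]; congr 1; simp [sgn]; ring
        · rw [← Complex.exp_neg_pi_div_two_mul_I]; congr 1; simp [sgn]; ring
    rw [rho, mul_assoc, wt_mul_det_inv]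
    simp only [F, D]
    push_cast
    have hdet : (Complex.exp (-((x + sgn s * Real.pi * Complex.I) / 2)) • P.2 -
        Complex.exp ((x + sgn s * Real.pi * Complex.I) / 2) • P.1).det =
        -(Complex.exp (-(x / 2)) • P.2 + Complex.exp (x / 2) • P.1).det := by
      have : Complex.exp (-((x + sgn s * Real.pi * Complex.I) / 2)) • P.2 -
          Complex.exp ((x + sgn s * Real.pi * Complex.I) / 2) • P.1 =
          (-u) • (Complex.exp (-(x / 2)) • P.2 + Complex.exp (x / 2) • P.1) := by
        rw [add_div, neg_add, Complex.exp_add, Complex.exp_add, hu1, hu2, smul_add, smul_smul, smul_smul,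
          sub_eq_add_neg, ← neg_smul]
        congr 2 <;> ring
      rw [this, Matrix.det_smul]
      simp [hu]
    rw [hdet, inv_neg, mul_neg, neg_add]
  have i0 : Integrable fun x : ℝ => F (x + (0 : ℝ) * Complex.I) := by
    simp only [e0]
    exact integrable_kerInt (P := (-P.1, P.2)) (integrable_rho k 0) (neg_fst_mem_segSet (Λ_subset_Ω s hP))
  have i1 : Integrable fun x : ℝ => F (x + (sgn s * Real.pi : ℝ) * Complex.I) := by
    simp only [e1]
    exact (integrable_kerInt (integrable_rho k _) hseg).neg
  obtain ⟨C, hC0, hC⟩ := exists_decay_bound k Real.pi Real.pi_pos.le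
  have hbound : ∀ x y : ℝ, |y| ≤ Real.pi → 0 ≤ sgn s * Real.sin y →
      ‖F (x + y * Complex.I)‖ ≤ (C / (‖P.2.det‖ * (c₁ * c₂))) * (1 + x ^ 2)⁻¹ := by
    intro x y hy hy'
    have hn : ‖-(x + y * Complex.I : ℂ)‖ ≤ |x| + Real.pi := by
      rw [norm_neg]
      refine (norm_add_le _ _).trans ?_
      simp only [Complex.norm_real, norm_mul, Complex.norm_I, mul_one, Real.norm_eq_abs]
      linarith
    have hch := chw_pos x
    simp only [F]
    rw [norm_mul, norm_pow, norm_inv]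
    calc ‖-(x + y * Complex.I : ℂ)‖ ^ k * ‖D (x + y * Complex.I)‖⁻¹
        ≤ (|x| + Real.pi) ^ k * (‖P.2.det‖ * (c₁ * c₂) * chw x ^ 2)⁻¹ := by
          have := hD x y hy'
          gcongr
      _ = ((|x| + Real.pi) ^ k * wt x) / (‖P.2.det‖ * (c₁ * c₂)) := by
          rw [mul_inv, wt_eq_chw]; ring
      _ ≤ ((|x| + Real.pi) ^ k * Real.exp (-|x|)) / (‖P.2.det‖ * (c₁ * c₂)) := by
          have := wt_le x
          have := Real.pi_pos
          gcongr
      _ ≤ (C * (1 + x ^ 2)⁻¹) / (‖P.2.det‖ * (c₁ * c₂)) :=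
          div_le_div_of_nonneg_right (hC x) hK.le
      _ = _ := by ring
  have hdiff : ∀ z : ℂ, 0 ≤ sgn s * Real.sin z.im → DifferentiableAt ℂ F z := by
    intro z hz
    have hne := hDne z.re z.im hz
    rw [Complex.re_add_im] at hne
    exact DifferentiableAt.mul (by fun_prop) ((hDd z).inv hne)
  have main : ∫ x : ℝ, F (x + (0 : ℝ) * Complex.I) =
      ∫ x : ℝ, F (x + (sgn s * Real.pi : ℝ) * Complex.I) := by
    have hpi := Real.pi_pos
    cases s
    · refine (integral_horizontal_eq (C := C / (‖P.2.det‖ * (c₁ * c₂))) (by simp [sgn]; linarith)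
        (fun z h1 h2 => hdiff z ?_) i1 i0 fun x y _ h1 h2 => hbound x y ?_ ?_).symm
      · simp only [sgn, Bool.false_eq_true, if_false, neg_mul, one_mul] at h1 ⊢
        linarith [Real.sin_nonpos_of_nonpos_of_neg_pi_le h2 h1]
      · simp only [sgn, Bool.false_eq_true, if_false, neg_mul, one_mul] at h1
        exact abs_le.2 ⟨h1, by linarith⟩
      · simp only [sgn, Bool.false_eq_true, if_false, neg_mul, one_mul] at h1 ⊢
        linarith [Real.sin_nonpos_of_nonpos_of_neg_pi_le h2 h1]
    · refine integral_horizontal_eq (C := C / (‖P.2.det‖ * (c₁ * c₂))) (by simp [sgn]; linarith)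
        (fun z h1 h2 => hdiff z ?_) i0 i1 fun x y _ h1 h2 => hbound x y ?_ ?_
      · simp only [sgn, if_true, one_mul] at h2 ⊢
        exact Real.sin_nonneg_of_nonneg_of_le_pi h1 h2
      · simp only [sgn, if_true, one_mul] at h2
        exact abs_le.2 ⟨by linarith, h2⟩
      · simp only [sgn, if_true, one_mul] at h2 ⊢
        exact Real.sin_nonneg_of_nonneg_of_le_pi h1 h2
  simp only [e0, e1] at main
  rw [integral_neg] at main
  exact main

/-! ### Realization of the convolution powers -/

/-- The sum over dual labels is a trace, by multiplicativity of `tMat`. -/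
lemma sum_basisFn_mul (L : ℕ) (A B : HC) :
    ∑ p : Fin (L + 1) × Fin (L + 1), basisFn (true, ⟨L, p⟩) A * basisFn (false, ⟨L, p⟩) B =
      B.det⁻¹ * (tMat L (A * B⁻¹)).trace := by
  rw [tMat_mul, Matrix.trace, Fintype.sum_prod_type, Finset.mul_sum]
  refine Finset.sum_congr rfl fun n _ => ?_
  rw [Matrix.diag_apply, Matrix.mul_apply, Finset.mul_sum]
  refine Finset.sum_congr rfl fun m _ => ?_
  simp only [basisFn, tMat_apply]
  ring

lemma blockSum_dualArr_of_ne (x y : ℕ → ℂ) (ε : Bool) {L L' : ℕ} (h : L ≠ L') (P : HC × HC) :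
    blockSum (dualArr x y) ε (!ε) L L' P = 0 := by
  refine Finset.sum_eq_zero fun p _ => Finset.sum_eq_zero fun q _ => ?_
  have : dualArr x y (ε, ⟨L, p⟩) (!ε, ⟨L', q⟩) = 0 :=
    if_neg fun h' => h (congrArg Sigma.fst h'.2)
  rw [this, zero_mul, zero_mul]

lemma blockSum_dualArr_same (x y : ℕ → ℂ) (ε : Bool) (L : ℕ) (P : HC × HC) :
    blockSum (dualArr x y) ε (!ε) L L P = (if ε then x L else y L) *
      ∑ p : Fin (L + 1) × Fin (L + 1), basisFn (ε, ⟨L, p⟩) P.1 * basisFn (!ε, ⟨L, p⟩) P.2 := by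
  rw [blockSum, Finset.mul_sum]
  refine Finset.sum_congr rfl fun p _ => ?_
  rw [Finset.sum_eq_single p]
  · have : dualArr x y (ε, ⟨L, p⟩) (!ε, ⟨L, p⟩) = if ε then x L else y L :=
      if_pos ⟨by cases ε <;> simp, rfl⟩
    rw [this, mul_assoc]
  · intro q _ hq
    have : dualArr x y (ε, ⟨L, p⟩) (!ε, ⟨L, q⟩) = 0 :=
      if_neg fun h' => hq (by simpa using h'.2.symm)
    rw [this, zero_mul, zero_mul]
  · simp

/-- The blocks with L ≠ L' vanish, so the double series is supported on the diagonal. -/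
lemma hasSum_blockSum_dualArr (x y : ℕ → ℂ) (ε : Bool) (P : HC × HC) {S : ℂ}
    (h : HasSum (fun L => blockSum (dualArr x y) ε (!ε) L L P) S) :
    HasSum (fun LL : ℕ × ℕ => blockSum (dualArr x y) ε (!ε) LL.1 LL.2 P) S := by
  have hinj : Function.Injective fun L : ℕ => (L, L) := fun a b hab => (Prod.ext_iff.1 hab).1
  refine (hinj.hasSum_iff ?_).1 h
  rintro ⟨L, L'⟩ hL
  exact blockSum_dualArr_of_ne x y ε (fun h' => hL ⟨L, by rw [show L' = L from h'.symm]⟩) P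

lemma finitePart_dualArr (x y : ℕ → ℂ) (ε : Bool) (P : HC × HC) :
    finitePart (dualArr x y) ε P = 0 := by
  have : ∀ p : Lab × Lab, dualArr x y (ε, p.1) (ε, p.2) = 0 := fun p => if_neg fun h => h.1 rfl
  simp [finitePart, this]

lemma posDef_of_mem_DR {R : ℝ} {A B : HC} (hA : A ∈ DR true R) (hB : B ∈ DR false R) :
    (B * Bᴴ - A * Aᴴ).PosDef := by
  have h := Matrix.PosDef.add (show (((R : ℂ) ^ 2) • (1 : HC) - A * Aᴴ).PosDef from hA)
    (show (B * Bᴴ - ((R : ℂ) ^ 2) • (1 : HC)).PosDef from hB)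
  have e : (((R : ℂ) ^ 2) • (1 : HC) - A * Aᴴ) + (B * Bᴴ - ((R : ℂ) ^ 2) • (1 : HC)) =
      B * Bᴴ - A * Aᴴ := by abel
  rwa [e] at h

lemma analyticAt_halfInt_comp (k : ℕ) (T : HC × HC →L[ℂ] HC × HC) {P : HC × HC} (hP : T P ∈ segSet) :
    AnalyticAt ℂ (fun Q => halfInt k (T Q)) P :=
  (analyticAt_kerInt (integrable_indicator_rho k) hP).comp (T.analyticAt P)

/-- The coefficients of the convolution powers of `I(N(Z)⁻¹)`. -/
def powArr (k : ℕ) : Arr :=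
  dualArr (fun L => -(1 / (L + 1)) ^ (k + 1)) (fun L => (-(1 / (L + 1))) ^ (k + 1))

lemma factorial_ne_zero_complex (k : ℕ) : (k.factorial : ℂ) ≠ 0 := by
  exact_mod_cast k.factorial_ne_zero

lemma isExtension_powArr_true_false (k : ℕ) : IsExtension (powArr k) true false
    (fun P => -(-1) ^ k / k.factorial * halfInt k (P.2, -P.1)) := by
  refine ⟨fun P hP => analyticAt_const.mul (analyticAt_halfInt_comp k
    ((ContinuousLinearMap.snd ℂ HC HC).prod (-ContinuousLinearMap.fst ℂ HC HC))
    (swap_neg_mem_segSet hP)), ?_⟩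
  intro R _ P hP h1 h2
  have h := (hasSum_halfInt k (posDef_of_mem_DR h1 h2) hP.2.1).mul_left (-(-1) ^ k / k.factorial : ℂ)
  refine hasSum_blockSum_dualArr _ _ true P (h.congr_fun ?_)
  intro L
  rw [blockSum_dualArr_same, if_pos rfl]
  rw [show (∑ p : Fin (L + 1) × Fin (L + 1), basisFn (true, ⟨L, p⟩) P.1 * basisFn (!true, ⟨L, p⟩) P.2) =
    P.2.det⁻¹ * (tMat L (P.1 * P.2⁻¹)).trace from sum_basisFn_mul L P.1 P.2]
  have hf := factorial_ne_zero_complex k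
  have hs : ((-1 : ℂ) ^ k) * (-1) ^ k = 1 := by rw [← mul_pow]; simp
  have hL : ((L : ℂ) + 1) ^ (k + 1) ≠ 0 := pow_ne_zero _ (by exact_mod_cast L.succ_ne_zero)
  rw [div_pow, one_pow]
  field_simp
  rw [sq, hs, mul_one]

lemma isExtension_powArr_false_true (k : ℕ) : IsExtension (powArr k) false true
    (fun P => -1 / k.factorial * halfInt k (P.1, -P.2)) := by
  refine ⟨fun P hP => analyticAt_const.mul (analyticAt_halfInt_comp k
    ((ContinuousLinearMap.fst ℂ HC HC).prod (-ContinuousLinearMap.snd ℂ HC HC))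
    (neg_snd_mem_segSet hP)), ?_⟩
  intro R _ P hP h1 h2
  have h := (hasSum_halfInt k (posDef_of_mem_DR h2 h1) hP.1).mul_left (-1 / k.factorial : ℂ)
  refine hasSum_blockSum_dualArr _ _ false P (h.congr_fun ?_)
  intro L
  rw [blockSum_dualArr_same, if_neg Bool.false_ne_true]
  rw [show (∑ p : Fin (L + 1) × Fin (L + 1), basisFn (false, ⟨L, p⟩) P.1 * basisFn (!false, ⟨L, p⟩) P.2) =
    P.1.det⁻¹ * (tMat L (P.2 * P.1⁻¹)).trace by
      rw [← sum_basisFn_mul L P.2 P.1]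
      exact Finset.sum_congr rfl fun _ _ => mul_comm _ _]
  have hf := factorial_ne_zero_complex k
  have hL : ((L : ℂ) + 1) ^ (k + 1) ≠ 0 := pow_ne_zero _ (by exact_mod_cast L.succ_ne_zero)
  rw [neg_pow, pow_succ (-1 : ℂ), div_pow, one_pow]
  field_simp

/-- The line is cut at 0 and the negative half is reflected by x ↦ -x, which exchanges the roles of
Z₁ and Z₂. -/
lemma kerInt_eq_add_halfInt (k : ℕ) {P : HC × HC} (hP : P ∈ Ω) :
    kerInt (rho k 0) (-P.1, P.2) = (-1) ^ k * halfInt k (P.2, -P.1) + halfInt k (P.1, -P.2) := by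
  have hint := integrable_kerInt (integrable_rho k 0) (neg_fst_mem_segSet hP)
  have e : ∀ x : ℝ, rho k 0 x *
      ((1 - (Real.sigmoid x : ℂ)) • P.2 + (Real.sigmoid x : ℂ) • -P.1).det⁻¹ = (-(x : ℂ)) ^ k *
      ((Real.exp (-(x / 2)) : ℂ) • P.2 + (Real.exp (x / 2) : ℂ) • -P.1).det⁻¹ := fun x => by
    rw [rho, add_zero, mul_assoc, wt_mul_det_inv]
  rw [kerInt]
  simp only [e] at hint ⊢
  rw [← setIntegral_univ, ← Set.Iic_union_Ioi (a := (0 : ℝ)), setIntegral_union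
    (Set.Iic_disjoint_Ioi le_rfl) measurableSet_Ioi hint.integrableOn hint.integrableOn]
  congr 1
  · have := integral_comp_neg_Ioi (0 : ℝ) fun x : ℝ => (-(x : ℂ)) ^ k *
      ((Real.exp (-(x / 2)) : ℂ) • P.2 + (Real.exp (x / 2) : ℂ) • -P.1).det⁻¹
    rw [neg_zero] at this
    rw [← this, halfInt_eq, ← integral_const_mul]
    refine setIntegral_congr_fun measurableSet_Ioi fun x _ => ?_
    simp only [Complex.ofReal_neg, neg_neg, neg_div]
    rw [neg_pow (x : ℂ), ← mul_assoc, ← mul_assoc, ← mul_pow, neg_mul_neg, one_mul, one_pow, one_mul,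
      add_comm]
  · rw [halfInt_eq]
    refine setIntegral_congr_fun measurableSet_Ioi fun x _ => ?_
    rw [← det_neg_HC, neg_add, smul_neg, smul_neg, neg_neg]

lemma isRealization_powArr (k : ℕ) :
    IsRealization (powArr k) fun P => -1 / k.factorial * kerInt (rho k 0) (-P.1, P.2) := by
  refine ⟨_, _, isExtension_powArr_true_false k, isExtension_powArr_false_true k, fun P hP => ?_⟩
  beta_reduce
  rw [powArr, finitePart_dualArr, finitePart_dualArr, kerInt_eq_add_halfInt k hP]
  ring

/-! ### Extension across the diagonal and diagonal limits -/

lemma realization_eq_on_Λ (k : ℕ) {s : Bool} {P : HC × HC} (hP : P ∈ Λ s) (hseg : P ∈ segSet) :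
    -1 / k.factorial * kerInt (rho k 0) (-P.1, P.2) =
      1 / k.factorial * kerInt (rho k (-(sgn s * Real.pi * Complex.I))) P := by
  rw [kerInt_shift k hP hseg]
  ring

lemma isExtendable_powArr (k : ℕ) : IsExtendable (powArr k) := by
  refine ⟨by rw [powArr, ← nConv_NInv]; exact nConv_NInv_mem_HHω k, _, isRealization_powArr k, fun Z₀ =>
    -- One neighbourhood, `segSet`, serves all diagonal points, since a constant segment at an
    -- invertible matrix stays invertible.
    ⟨segSet, isOpen_segSet, diag_mem_segSet Z₀, fun P hP => det_ne_zero_of_mem_segSet hP, fun s =>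
    ⟨fun P => 1 / k.factorial * kerInt (rho k (-(sgn s * Real.pi * Complex.I))) P, ?_, ?_⟩⟩⟩
  · exact fun P hP => analyticAt_const.mul (analyticAt_kerInt (integrable_rho k _) hP)
  · exact fun P hP => realization_eq_on_Λ k hP.1 hP.2

/-- After the shift the integrand is regular at the diagonal; there the determinant no longer
depends on x and leaves the moment. -/
lemma hasDiag_powArr (k : ℕ) (s : Bool) :
    HasDiag s (powArr k) fun Z =>
      moment k (-(sgn s * Real.pi * Complex.I)) / k.factorial * (Z : HC).det⁻¹ := by
  refine ⟨_, isRealization_powArr k, fun Z => ?_⟩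
  have h1 : Tendsto (fun P => 1 / (k.factorial : ℂ) * kerInt (rho k (-(sgn s * Real.pi * Complex.I))) P)
      (𝓝[Λ s] ((Z : HC), (Z : HC)))
      (𝓝 (moment k (-(sgn s * Real.pi * Complex.I)) / k.factorial * (Z : HC).det⁻¹)) := by
    have hc := (analyticAt_kerInt (integrable_rho k (-(sgn s * Real.pi * Complex.I)))
      (diag_mem_segSet Z)).continuousAt
    have := (hc.tendsto.const_mul (1 / (k.factorial : ℂ))).mono_left (nhdsWithin_le_nhds (s := Λ s))
    rw [kerInt_diag] at this
    convert! this using 2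
    rw [moment]
    ring
  refine h1.congr' ?_
  filter_upwards [self_mem_nhdsWithin, nhdsWithin_le_nhds (isOpen_segSet.mem_nhds (diag_mem_segSet Z))]
    with P hP hseg
  exact (realization_eq_on_Λ k hP hseg).symm

lemma nConv_eq_powArr {n : ℕ} (hn : 1 ≤ n) : nConv (mapI NInv) n = powArr (n - 1) := by
  obtain ⟨k, rfl⟩ := Nat.exists_eq_add_of_le' hn
  rw [nConv_NInv]
  rfl

lemma hasDiag_nConv_true {n : ℕ} (hn : 1 ≤ n) :
    HasDiag true (nConv (mapI NInv) n) fun Z => kappaPlus n * (Z : HC).det⁻¹ := by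
  rw [nConv_eq_powArr hn]
  have h := hasDiag_powArr (n - 1) true
  have e : (-((sgn true : ℂ) * Real.pi * Complex.I)) = -(Real.pi * Complex.I) := by simp [sgn]
  rw [e, moment_neg_pi_I, ← Polynomial.bernoulli_eval_zero] at h
  exact h

lemma hasDiag_nConv_false {n : ℕ} (hn : 1 ≤ n) :
    HasDiag false (nConv (mapI NInv) n) fun Z => kappaMinus n * (Z : HC).det⁻¹ := by
  rw [nConv_eq_powArr hn]
  have h := hasDiag_powArr (n - 1) false
  have e : (-((sgn false : ℂ) * Real.pi * Complex.I)) = Real.pi * Complex.I := by simp [sgn]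
  rw [e, moment_pi_I, ← Polynomial.bernoulli_eval_one] at h
  exact h

lemma isExtendable_nConv {n : ℕ} (hn : 1 ≤ n) : IsExtendable (nConv (mapI NInv) n) := by
  rw [nConv_eq_powArr hn]
  exact isExtendable_powArr _

/-! ### Products of constants -/

lemma constArr_eq_zero_of_ne (c : ℂ) {i j : Idx} (h : i.1 ≠ j.1) : constArr c i j = 0 :=
  if_neg fun h' => h (by rw [h'.1, h'.2])

lemma isExtension_constArr (c : ℂ) {ε ε' : Bool} (h : ε ≠ ε') :
    IsExtension (constArr c) ε ε' fun _ => 0 := by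
  refine ⟨fun P _ => analyticAt_const, fun R _ P _ _ _ => ?_⟩
  have : ∀ L L', blockSum (constArr c) ε ε' L L' P = 0 := fun L L' =>
    Finset.sum_eq_zero fun p _ => Finset.sum_eq_zero fun q _ => by
      rw [constArr_eq_zero_of_ne c h, zero_mul, zero_mul]
  simp only [this]
  exact hasSum_zero

lemma isRealization_constArr (c : ℂ) : IsRealization (constArr c) fun _ => c := by
  refine ⟨_, _, isExtension_constArr c (by simp), isExtension_constArr c (by simp), fun P _ => ?_⟩
  have h1 : finitePart (constArr c) true P = c := by
    rw [finitePart, finsum_eq_single _ (lab0, lab0)]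
    · simp [constArr, basisFn_lab0]
    · intro p hp
      have : constArr c (true, p.1) (true, p.2) = 0 :=
        if_neg fun h => hp (Prod.ext (Prod.mk.inj h.1).2 (Prod.mk.inj h.2).2)
      rw [this, zero_mul, zero_mul]
  have h2 : finitePart (constArr c) false P = 0 := by
    have : ∀ p : Lab × Lab, constArr c (false, p.1) (false, p.2) = 0 := fun p =>
      if_neg fun h => Bool.false_ne_true (Prod.ext_iff.1 h.1).1
    simp [finitePart, this]
  rw [h1, h2]
  ring

lemma isExtendable_constArr (c : ℂ) : IsExtendable (constArr c) := by
  refine ⟨constArr_mem_HHω c, _, isRealization_constArr c, fun Z₀ =>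
    ⟨segSet, isOpen_segSet, diag_mem_segSet Z₀, fun P hP => det_ne_zero_of_mem_segSet hP, fun s =>
    ⟨fun _ => c, fun P _ => analyticAt_const, fun P _ => rfl⟩⟩⟩

/-- The convolution is the constant c, so both diagonal limits are trivial. -/
lemma isProd_smul_NInv_one (s : Bool) (c : ℂ) : IsProd s (c • NInv) 1 (c • (1 : Zh)) := by
  rw [IsProd, conv_smul_NInv_one]
  refine ⟨isExtendable_constArr c, _, isRealization_constArr c, fun Z => ?_⟩
  have : ((c • (1 : Zh) : Zh) : HCx → ℂ) Z = c := by simp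
  rw [this]
  exact tendsto_const_nhds

lemma kappaPlus_two : kappaPlus 2 = -(Real.pi * Complex.I) := by
  simp [kappaPlus]
  ring

lemma kappaMinus_two : kappaMinus 2 = Real.pi * Complex.I := by
  simp [kappaMinus]
  ring

lemma isProd_NInv_true :
    IsProd true NInv NInv ((-((Real.pi : ℂ) * Complex.I)) • NInv) := by
  refine ⟨isExtendable_nConv (n := 2) (by norm_num), ?_⟩
  have h := hasDiag_nConv_true (n := 2) (by norm_num)
  rw [kappaPlus_two] at h
  exact h

lemma isProd_NInv_false :
    IsProd false NInv NInv (((Real.pi : ℂ) * Complex.I) • NInv) := by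
  refine ⟨isExtendable_nConv (n := 2) (by norm_num), ?_⟩
  have h := hasDiag_nConv_false (n := 2) (by norm_num)
  rw [kappaMinus_two] at h
  exact h

/-- For the triple N⁻¹, N⁻¹, 1 one bracketing gives the constant c, the other gives 1. -/
lemma exists_not_assoc (s : Bool) {c : ℂ} (hc : c ≠ 1) (h : IsProd s NInv NInv (c • NInv)) :
    ∃ f g h fg gh p q : Zh, IsProd s f g fg ∧ IsProd s g h gh ∧ IsProd s fg h p ∧
      IsProd s f gh q ∧ p ≠ q := by
  have h1 : IsProd s NInv 1 1 := by simpa using isProd_smul_NInv_one s 1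
  refine ⟨NInv, NInv, 1, c • NInv, 1, c • (1 : Zh), 1, h, h1, isProd_smul_NInv_one s c, h1, fun e => hc ?_⟩
  have := congrFun (congrArg (fun f : Zh => (f : HCx → ℂ)) e) 1
  simpa using this

end QuatAlg

end

theorem mainTheorem12 :
    (∀ n : ℕ, 1 ≤ n →
      QuatAlg.IsExtendable (QuatAlg.nConv (QuatAlg.mapI QuatAlg.NInv) n) ∧
      QuatAlg.HasDiag true (QuatAlg.nConv (QuatAlg.mapI QuatAlg.NInv) n)
        (fun Z => QuatAlg.kappaPlus n * (Z : QuatAlg.HC).det⁻¹) ∧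
      QuatAlg.HasDiag false (QuatAlg.nConv (QuatAlg.mapI QuatAlg.NInv) n)
        (fun Z => QuatAlg.kappaMinus n * (Z : QuatAlg.HC).det⁻¹)) ∧
    QuatAlg.IsProd true QuatAlg.NInv QuatAlg.NInv
      ((-((Real.pi : ℂ) * Complex.I)) • QuatAlg.NInv) ∧
    QuatAlg.IsProd false QuatAlg.NInv QuatAlg.NInv
      (((Real.pi : ℂ) * Complex.I) • QuatAlg.NInv) ∧
    (∀ s : Bool, ∃ f g h fg gh p q : QuatAlg.Zh,
      QuatAlg.IsProd s f g fg ∧ QuatAlg.IsProd s g h gh ∧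
      QuatAlg.IsProd s fg h p ∧ QuatAlg.IsProd s f gh q ∧ p ≠ q) := by
  -- The constants ∓πi are purely imaginary, hence different from 1.
  have hre : ∀ c : ℂ, c.re = 0 → c ≠ 1 := fun c h h1 => by simp [h1] at h
  refine ⟨fun n hn => ⟨QuatAlg.isExtendable_nConv hn, QuatAlg.hasDiag_nConv_true hn,
    QuatAlg.hasDiag_nConv_false hn⟩, QuatAlg.isProd_NInv_true, QuatAlg.isProd_NInv_false, fun s => ?_⟩
  cases s
  · exact QuatAlg.exists_not_assoc false (hre _ (by simp)) QuatAlg.isProd_NInv_false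
  · exact QuatAlg.exists_not_assoc true (hre _ (by simp)) QuatAlg.isProd_NInv_true
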